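/- **Plant.** Let $N=n+\bar N$, $m=\sum_{i=1}^p m_i$, and consider the linear parameter-varying (LPV) system in linear-fractional (LFT) form $$\begin{bmatrix} z_{k+1}\\ \varphi_k\\ e_k\\ \hat y_k\end{bmatrix}=\begin{bmatrix}A_{ss}&A_{sp}&B_{1s}&B_{2s}\\A_{ps}&A_{pp}&B_{1p}&B_{2p}\\C_{1s}&C_{1p}&D_{11}&D_{12}\\C_{2s}&C_{2p}&D_{21}&0\end{bmatrix}\begin{bmatrix}z_k\\ \vartheta_k\\ d_k\\ u_k\end{bmatrix},\qquad \vartheta_k=\mathrm{diag}\big(\delta^{[1]}_kI_{m_1},\dots,\delta^{[p]}_kI_{m_p}\big)\varphi_k,\qquad z_0\in\mathbb I,\quad k=0,1,2,\dots,$$ with real constant matrices, $z_k,\hat y_k\in\mathbb R^N$, $\varphi_k,\vartheta_k\in\mathbb R^m$, $d_k\in\mathbb R^{n_d}$, $e_k\in\mathbb R^{n_e}$, $u_k\in\mathbb R^{n_u}$. A scheduling trajectory $\delta$ is admissible if $|\delta_k^{[i]}|\le 1$ for all $k,i$; let $\boldsymbol\delta$ be the set of admissible trajectories. For positive definite $P\in\mathbb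 R^{n\times n}$ and $Q\in\mathbb R^{\bar N\times\bar N}$ let $\mathbb I=\{(\bar p,\bar q)\mid \bar p^TP\bar p\le 1,\ \bar q^TQ\bar q\le 1\}$ and $\Gamma=\mathrm{diag}(P^{-1/2},Q^{-1/2})$. Suppose the state is exactly measurable, i.e. $C_{2s}=I$, $C_{2p}=0$, $D_{21}=0$. Put $$H=\begin{bmatrix}H_{11}&H_{12}\\H_{21}&H_{22}\end{bmatrix}=\left[\begin{array}{c|cc}A_{ss}&A_{sp}&B_{1s}\\ \hline A_{ps}&A_{pp}&B_{1p}\\ C_{1s}&C_{1p}&D_{11}\end{array}\right],\qquad \mathrm{Im}\,N_R=\mathrm{Ker}\begin{bmatrix}B_{2s}^T&B_{2p}^T&D_{12}^T\end{bmatrix},\quad N_R^TN_R=I.$$ **Theorem.** Let $\gamma\in\mathbb R$ and let $\bar h\ge 0$ be an integer. Suppose there are symmetric positive definite matrices $R_0(k)\in\mathbb R^{N\times N}$, $R_i(k),S_i(k)\in\mathbb R^{m_i\times m_i}$ ($i=1,\dots,p$, $k=0,\dots,\bar h$) and positive scalars $b,f_{11},f_{12},f_2,g,t$ such that, with $R_0(\bar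 h+1)=R_0(\bar h)$, $F_1=\mathrm{diag}(f_{11}I_n,f_{12}I_{\bar N})$, $\bar R(k)=\mathrm{diag}(R_1(k),\dots,R_p(k))$, $\bar S(k)=\mathrm{diag}(S_1(k),\dots,S_p(k))$, $$b+f_{11}+f_{12}+f_2<2\gamma,\qquad \begin{bmatrix}F_1&\Gamma^T\\ \Gamma&R_0(0)\end{bmatrix}\succ0,$$ $$N_R^T\big\{H\,\mathrm{diag}(R_0(k),\bar R(k),gI)\,H^T-\mathrm{diag}(R_0(k+1),\bar R(k),bI)\big\}N_R\prec0,$$ $$\begin{bmatrix}\mathrm{diag}(\bar S(k),f_2I)-H_{22}^T\mathrm{diag}(\bar S(k),tI)H_{22}&H_{12}^T\\H_{12}&R_0(k+1)\end{bmatrix}\succ0,$$ $$\begin{bmatrix}R_i(k)&I\\I&S_i(k)\end{bmatrix}\succeq0,\qquad\begin{bmatrix}g&1\\1&f_2\end{bmatrix}\succeq0,\qquad\begin{bmatrix}t&1\\1&b\end{bmatrix}\succeq0$$ for all $i=1,\dots,p$ and $k=0,\dots,\bar h$. Then there is a static state-feedback $(\bar h,1)$-eventually periodic nonstationary LPV (NSLPV)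 controller $$\begin{bmatrix}\varphi^c_k\\u_k\end{bmatrix}=\begin{bmatrix}A^c_{pp}(k)&B^c_p(k)\\C^c_p(k)&D^c(k)\end{bmatrix}\begin{bmatrix}\vartheta^c_k\\\hat y_k\end{bmatrix},\qquad\vartheta^c_k=\mathrm{diag}\big(\delta^{[1]}_kI_{m^c_1(k)},\dots,\delta^{[p]}_kI_{m^c_p(k)}\big)\varphi^c_k,\qquad m^c_i(k)\le m_i,$$ with matrices and dimensions independent of $k$ for $k\ge\bar h$, such that the closed loop is well-posed (for all $\delta\in\boldsymbol\delta$, $z_0\in\mathbb R^N$ and disturbances $d$, all signals exist and are unique), robustly stable (there are $c$ and $\rho\in[0,1)$ with $\|z_{j+k}\|_2\le c\rho^k\|z_j\|_2$ for all $j,k\ge0$ and all $\delta\in\boldsymbol\delta$ when $d=0$), and $$\sup\{\|e\|_{\ell_2}\mid\|d\|_{\ell_2}\le1,\ \delta\in\boldsymbol\delta,\ z_0\in\mathbb I\}<\gamma .$$ -/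

import Mathlib

open scoped ENNReal

/-- Index set of the lifted state `z = (x, φ̄)`, of dimension `N = n + n̄`. -/
abbrev StateIdx (n nb : ℕ) : Type := Fin n ⊕ Fin nb

/-- Index set of a signal partitioned into `p` channels of sizes `m 1, …, m p`. -/
abbrev ChanIdx {p : ℕ} (m : Fin p → ℕ) : Type := (i : Fin p) × Fin (m i)

/-- The Euclidean norm `(vᵀ v)^{1/2}`. -/
noncomputable def euclNorm {ι : Type*} [Fintype ι] (v : ι → ℝ) : ℝ :=
  Real.sqrt (v ⬝ᵥ v)

/-- The `ℓ₂`-norm `(∑ₖ dₖᵀ dₖ)^{1/2}` of a sequence, with value `∞` if it is not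
square-summable. In particular `ell2Norm d ≤ 1` says `d ∈ ℓ₂` and `‖d‖ ≤ 1`. -/
noncomputable def ell2Norm {ι : Type*} [Fintype ι] (d : ℕ → ι → ℝ) : ℝ≥0∞ :=
  (∑' k, ENNReal.ofReal (d k ⬝ᵥ d k)) ^ (1 / 2 : ℝ)

/-- The ellipsoid `{y | yᵀ P y ≤ 1}`. -/
def ellipsoid {ι : Type*} [Fintype ι] (P : Matrix ι ι ℝ) : Set (ι → ℝ) :=
  {y | y ⬝ᵥ (P.mulVec y) ≤ 1}

/-- The set of initial states `(p̄, q̄)` with `p̄ ∈ ε(P)` and `q̄ ∈ ε(Q)`. -/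
def initialSet {n nb : ℕ} (P : Matrix (Fin n) (Fin n) ℝ) (Q : Matrix (Fin nb) (Fin nb) ℝ) :
    Set (StateIdx n nb → ℝ) :=
  {z | (fun i => z (Sum.inl i)) ∈ ellipsoid P ∧ (fun i => z (Sum.inr i)) ∈ ellipsoid Q}

/-- A sequence is `(h, q)`-eventually periodic. -/
def IsEventuallyPeriodic {α : Type*} (h q : ℕ) (a : ℕ → α) : Prop :=
  1 ≤ q ∧ ∀ i k : ℕ, a (h + k + i * q) = a (h + k)

/-- Scheduling trajectories with `|δₖ^[i]| ≤ 1` for all `k` and `i`. -/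
def Admissible {p : ℕ} (δ : ℕ → Fin p → ℝ) : Prop :=
  ∀ k i, |δ k i| ≤ 1

/-- `diag(δ₁ I_{m₁}, …, δ_p I_{m_p})`. -/
def schedMatrix {p : ℕ} (m : Fin p → ℕ) (δ : Fin p → ℝ) :
    Matrix (ChanIdx m) (ChanIdx m) ℝ :=
  Matrix.blockDiagonal' fun i => δ i • (1 : Matrix (Fin (m i)) (Fin (m i)) ℝ)

/-- State-space matrices of the nominal LTI plant `G` of the LFT system (with zero
feedthrough from the control input to the measurement). -/
structure LFTPlant (n nb : ℕ) {p : ℕ} (m : Fin p → ℕ) (nd ne nu : ℕ) where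
  Ass : Matrix (StateIdx n nb) (StateIdx n nb) ℝ
  Asp : Matrix (StateIdx n nb) (ChanIdx m) ℝ
  B1s : Matrix (StateIdx n nb) (Fin nd) ℝ
  B2s : Matrix (StateIdx n nb) (Fin nu) ℝ
  Aps : Matrix (ChanIdx m) (StateIdx n nb) ℝ
  App : Matrix (ChanIdx m) (ChanIdx m) ℝ
  B1p : Matrix (ChanIdx m) (Fin nd) ℝ
  B2p : Matrix (ChanIdx m) (Fin nu) ℝ
  C1s : Matrix (Fin ne) (StateIdx n nb) ℝ
  C1p : Matrix (Fin ne) (ChanIdx m) ℝ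
  D11 : Matrix (Fin ne) (Fin nd) ℝ
  D12 : Matrix (Fin ne) (Fin nu) ℝ
  C2s : Matrix (StateIdx n nb) (StateIdx n nb) ℝ
  C2p : Matrix (StateIdx n nb) (ChanIdx m) ℝ
  D21 : Matrix (StateIdx n nb) (Fin nd) ℝ

/-- The data at one time instant of a static controller in LFT form: the sizes of its
scheduling channels and its four matrices. -/
structure StaticGain (p n nb nu : ℕ) where
  dim : Fin p → ℕ
  App : Matrix (ChanIdx dim) (ChanIdx dim) ℝ
  Bp : Matrix (ChanIdx dim) (StateIdx n nb) ℝ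
  Cp : Matrix (Fin nu) (ChanIdx dim) ℝ
  D : Matrix (Fin nu) (StateIdx n nb) ℝ

/-- All signals of the interconnection of a plant with a static controller `K`; the
controller channel sizes may depend on time. -/
structure LoopSignals (n nb : ℕ) {p : ℕ} (m : Fin p → ℕ) (ne nu : ℕ)
    (K : ℕ → StaticGain p n nb nu) where
  z : ℕ → StateIdx n nb → ℝ
  φ : ℕ → ChanIdx m → ℝ
  ϑ : ℕ → ChanIdx m → ℝ
  e : ℕ → Fin ne → ℝ
  y : ℕ → StateIdx n nb → ℝ
  u : ℕ → Fin nu → ℝ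
  φc : ∀ k, ChanIdx (K k).dim → ℝ
  ϑc : ∀ k, ChanIdx (K k).dim → ℝ

section ClosedLoop

variable {n nb p : ℕ} {m : Fin p → ℕ} {nd ne nu : ℕ}

/-- `s` is a trajectory of the closed loop of the plant `(G, Δ)` and the static controller
`(K, Δ_c)`, where `Δ` and `Δ_c` are both generated by the scheduling trajectory `δ`, with
disturbance `d`. -/
structure IsClosedLoopTrajectory (G : LFTPlant n nb m nd ne nu)
    (K : ℕ → StaticGain p n nb nu) (δ : ℕ → Fin p → ℝ) (d : ℕ → Fin nd → ℝ)
    (s : LoopSignals n nb m ne nu K) : Prop where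
  state : ∀ k, s.z (k + 1) = G.Ass.mulVec (s.z k) + G.Asp.mulVec (s.ϑ k)
    + G.B1s.mulVec (d k) + G.B2s.mulVec (s.u k)
  channel : ∀ k, s.φ k = G.Aps.mulVec (s.z k) + G.App.mulVec (s.ϑ k)
    + G.B1p.mulVec (d k) + G.B2p.mulVec (s.u k)
  perf : ∀ k, s.e k = G.C1s.mulVec (s.z k) + G.C1p.mulVec (s.ϑ k)
    + G.D11.mulVec (d k) + G.D12.mulVec (s.u k)
  meas : ∀ k, s.y k = G.C2s.mulVec (s.z k) + G.C2p.mulVec (s.ϑ k) + G.D21.mulVec (d k)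
  sched : ∀ k, s.ϑ k = (schedMatrix m (δ k)).mulVec (s.φ k)
  ctrl_channel : ∀ k, s.φc k = (K k).App.mulVec (s.ϑc k) + (K k).Bp.mulVec (s.y k)
  ctrl_input : ∀ k, s.u k = (K k).Cp.mulVec (s.ϑc k) + (K k).D.mulVec (s.y k)
  ctrl_sched : ∀ k, s.ϑc k = (schedMatrix (K k).dim (δ k)).mulVec (s.φc k)

/-- The closed loop is well-posed: for every admissible scheduling trajectory, every initial
state and every disturbance, all signals of the loop exist and are uniquely determined. -/
def WellPosedLoop (G : LFTPlant n nb m nd ne nu) (K : ℕ → StaticGain p n nb nu) : Prop :=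
  ∀ δ : ℕ → Fin p → ℝ, Admissible δ → ∀ (z0 : StateIdx n nb → ℝ) (d : ℕ → Fin nd → ℝ),
    ∃! s : LoopSignals n nb m ne nu K, s.z 0 = z0 ∧ IsClosedLoopTrajectory G K δ d s

/-- Robust stability: the undisturbed closed loop is exponentially stable, uniformly over time
and over the admissible scheduling trajectories. -/
def RobustlyStableLoop (G : LFTPlant n nb m nd ne nu) (K : ℕ → StaticGain p n nb nu) : Prop :=
  ∃ c ρ : ℝ, 0 ≤ ρ ∧ ρ < 1 ∧ ∀ δ : ℕ → Fin p → ℝ, Admissible δ →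
    ∀ s : LoopSignals n nb m ne nu K, IsClosedLoopTrajectory G K δ 0 s →
      ∀ j k : ℕ, euclNorm (s.z (j + k)) ≤ c * ρ ^ k * euclNorm (s.z j)

/-- The supremum, in `[0, ∞]`, of `‖e‖_{ℓ₂}` over `‖d‖_{ℓ₂} ≤ 1`, admissible scheduling
trajectories and initial states in `𝕀`. -/
noncomputable def worstCaseOutput (G : LFTPlant n nb m nd ne nu)
    (K : ℕ → StaticGain p n nb nu) (𝕀 : Set (StateIdx n nb → ℝ)) : ℝ≥0∞ :=
  sSup {r | ∃ (δ : ℕ → Fin p → ℝ) (d : ℕ → Fin nd → ℝ) (s : LoopSignals n nb m ne nu K),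
    Admissible δ ∧ ell2Norm d ≤ 1 ∧ s.z 0 ∈ 𝕀 ∧ IsClosedLoopTrajectory G K δ d s ∧
      r = ell2Norm s.e}

end ClosedLoop

section Blocks

variable {n nb p : ℕ} {m : Fin p → ℕ} {nd ne nu : ℕ}

/-- `diag(A, B)`. -/
def diag2 {α β : Type*} (A : Matrix α α ℝ) (B : Matrix β β ℝ) : Matrix (α ⊕ β) (α ⊕ β) ℝ :=
  Matrix.fromBlocks A 0 0 B

/-- `diag(A, B, C)`. -/
def diag3 {α β κ : Type*} (A : Matrix α α ℝ) (B : Matrix β β ℝ) (C : Matrix κ κ ℝ) :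
    Matrix (α ⊕ (β ⊕ κ)) (α ⊕ (β ⊕ κ)) ℝ :=
  diag2 A (diag2 B C)

def LFTPlant.H12 (G : LFTPlant n nb m nd ne nu) :
    Matrix (StateIdx n nb) (ChanIdx m ⊕ Fin nd) ℝ :=
  Matrix.fromCols G.Asp G.B1s

def LFTPlant.H21 (G : LFTPlant n nb m nd ne nu) :
    Matrix (ChanIdx m ⊕ Fin ne) (StateIdx n nb) ℝ :=
  Matrix.fromRows G.Aps G.C1s

def LFTPlant.H22 (G : LFTPlant n nb m nd ne nu) :
    Matrix (ChanIdx m ⊕ Fin ne) (ChanIdx m ⊕ Fin nd) ℝ :=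
  Matrix.fromBlocks G.App G.B1p G.C1p G.D11

def LFTPlant.H (G : LFTPlant n nb m nd ne nu) :
    Matrix (StateIdx n nb ⊕ (ChanIdx m ⊕ Fin ne)) (StateIdx n nb ⊕ (ChanIdx m ⊕ Fin nd)) ℝ :=
  Matrix.fromBlocks G.Ass G.H12 G.H21 G.H22

/-- The matrix `[B₂ₛᵀ  B₂ₚᵀ  D₁₂ᵀ]`. -/
def LFTPlant.ctrlRow (G : LFTPlant n nb m nd ne nu) :
    Matrix (Fin nu) (StateIdx n nb ⊕ (ChanIdx m ⊕ Fin ne)) ℝ :=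
  Matrix.fromCols G.B2s.transpose (Matrix.fromCols G.B2p.transpose G.D12.transpose)

open scoped MatrixOrder Matrix.Norms.L2Operator in
/-- `Γ = diag(P^{-1/2}, Q^{-1/2})`, with the positive square roots of `P⁻¹` and `Q⁻¹`. -/
noncomputable def gammaMatrix (P : Matrix (Fin n) (Fin n) ℝ) (Q : Matrix (Fin nb) (Fin nb) ℝ) :
    Matrix (StateIdx n nb) (StateIdx n nb) ℝ :=
  diag2 (CFC.sqrt P⁻¹) (CFC.sqrt Q⁻¹)

end Blocks

/-! The storage function is `zᵀ R₀(k)⁻¹ z`, and the controller carries a copy of every scheduling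
channel of the plant. Since both copies are driven by the same `δ`, the quantity `θᵀ Y θ + (θ - θc)ᵀ
T (θ - θc)`, with block-diagonal positive semidefinite `Y` and `T`, does not increase from channel
outputs to channel inputs. It therefore suffices to find, for each `k`, a linear gain `(z, θc) ↦
(φc, u)` making one quadratic form negative: storage increase, plus weighted channel and performance
outputs, minus weighted channel and disturbance inputs.

Such a gain is a saddle strategy. The form is convex in the controller's choice `(φc, u)`, and the
`S`-inequality makes it strictly concave in the unmeasured `(θ, d)`. So it is enough that for each
fixed `(z, θc, θ, d)` some choice makes the form negative (`exists_linear_saddle_strategy`): the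
stationary point over `(z, θc)` depends linearly on it and gives a choice that works against all
`(θ, d)`. With full knowledge, `φc = φ` removes the `T`-term, and a suitable `u` exists by dualizing
the `R`-inequality on the kernel of `[B₂ₛᵀ B₂ₚᵀ D₁₂ᵀ]`
(`Matrix.exists_toQuadraticForm'_lt_of_dual`). The scalings are `Y = R⁻¹` and `Y + T = S + ηI` with
a small `η > 0`.

Strict dissipativity gives the rest: injectivity of the channel equations (well-posedness),
geometric decay of the storage (stability), and, by telescoping, `‖e‖² ≤ b (f₁₁ + f₁₂ + f₂)`. The
arithmetic-geometric mean inequality turns this into a bound below `γ`. -/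

/-! ### Saddle points and perturbations of quadratic forms. -/

section QuadraticForms

/-- If for every `(a, w) ≠ 0` some `v` makes a quadratic form, positive in `v` and negative
in `w`, negative, then `v` can be chosen linearly in `a` and independently of `w`. -/
theorem exists_linear_saddle_strategy {A V W : Type*} [AddCommGroup A] [Module ℝ A]
    [AddCommGroup V] [Module ℝ V] [FiniteDimensional ℝ V]
    [AddCommGroup W] [Module ℝ W] [FiniteDimensional ℝ W]
    (Q : QuadraticForm ℝ (A × V × W))
    (hV : ∀ v, v ≠ 0 → 0 < Q (0, v, 0)) (hW : ∀ w, w ≠ 0 → Q (0, 0, w) < 0)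
    (h : ∀ a w, (a, w) ≠ 0 → ∃ v, Q (a, v, w) < 0) :
    ∃ K : A →ₗ[ℝ] V, ∀ a w, (a, w) ≠ 0 → Q (a, K a, w) < 0 := by
  have hadd (x y : A × V × W) : Q (x + y) = Q x + Q y + Q.polarBilin x y := by
    simp [QuadraticMap.polar]
  let ι : V × W →ₗ[ℝ] A × V × W := LinearMap.inr ℝ A (V × W)
  let Φ : V × W →ₗ[ℝ] Module.Dual ℝ (V × W) := Q.polarBilin.compl₁₂ ι ι
  have hΦ : Function.Injective Φ := by
    rw [injective_iff_map_eq_zero]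
    rintro ⟨v, w⟩ hx
    -- Testing against `(v, -w)` cancels the cross terms and leaves `2 Q(0,v,0) - 2 Q(0,0,w)`, a sum
    -- of two nonnegative terms. Hence the form is nondegenerate on `V × W`.
    have h0 : Q.polarBilin (0, v, w) (0, v, -w) = 0 := by
      simpa [Φ, ι] using DFunLike.congr_fun hx (v, -w)
    have hQ : 2 * Q (0, v, 0) - 2 * Q (0, 0, w) = 0 := by
      have e1 := hadd (0, v, w) (0, v, -w)
      have e2 : ((0, v, w) : A × V × W) + (0, v, -w) = (2 : ℝ) • (0, v, 0) := by
        simp [two_smul]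
      have e3 := hadd (0, v, 0) (0, 0, w)
      have e4 := hadd (0, v, 0) (0, 0, -w)
      have e5 : ((0, 0, -w) : A × V × W) = -(0, 0, w) := by simp
      rw [e2, h0, QuadraticMap.map_smul] at e1
      rw [e5, QuadraticMap.map_neg, LinearMap.map_neg] at e4
      simp only [Prod.mk_add_mk, add_zero, zero_add, Prod.neg_mk, neg_zero, smul_eq_mul]
        at e1 e3 e4
      linarith
    have hv : v = 0 := by
      by_contra hv
      have := hV v hv
      by_cases hw : w = 0
      · subst hw
        have e : Q ((0, 0, 0) : A × V × W) = 0 := Q.map_zero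
        linarith
      · linarith [hW w hw]
    have hw : w = 0 := by
      by_contra hw
      have := hW w hw
      subst hv
      have e : Q ((0, 0, 0) : A × V × W) = 0 := Q.map_zero
      linarith
    simp [hv, hw]
  let e := LinearMap.linearEquivOfInjective Φ hΦ Subspace.dual_finrank_eq.symm
  let s : A →ₗ[ℝ] V × W :=
    -(e.symm.toLinearMap ∘ₗ Q.polarBilin.compl₁₂ (LinearMap.inl ℝ A (V × W)) ι)
  -- `s a` is the stationary point of `Q` on the fibre over `a`, so moving away from it within the
  -- fibre changes `Q` by a pure square term. It is a minimum in `v` and a maximum in `w`.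
  have hs (a : A) (y : V × W) : Q.polarBilin (a, s a) (0, y) = 0 := by
    have h1 : Φ (s a) = -(Q.polarBilin.compl₁₂ (LinearMap.inl ℝ A (V × W)) ι a) := by
      change e (s a) = _
      simp [s]
    have h2 := DFunLike.congr_fun h1 y
    have h3 : ((a, s a) : A × V × W) = (a, 0) + (0, s a) := by simp
    rw [h3, map_add, LinearMap.add_apply]
    simp only [Φ, ι, LinearMap.compl₁₂_apply, LinearMap.neg_apply, LinearMap.inr_apply,
      LinearMap.inl_apply] at h2
    linarith
  refine ⟨LinearMap.fst ℝ V W ∘ₗ s, fun a w haw => ?_⟩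
  have hv (v : V) : Q (a, v, (s a).2) = Q (a, s a) + Q (0, v - (s a).1, 0) := by
    have := hadd (a, s a) (0, v - (s a).1, 0)
    rw [hs] at this
    rw [← add_zero (_ + _), ← this]
    congr 1
    ext <;> simp
  have hw : Q (a, (s a).1, w) = Q (a, s a) + Q (0, 0, w - (s a).2) := by
    have := hadd (a, s a) (0, 0, w - (s a).2)
    rw [hs] at this
    rw [← add_zero (_ + _), ← this]
    congr 1
    ext <;> simp
  have hW' (w : W) : Q (0, 0, w) ≤ 0 := by
    by_cases hw : w = 0
    · subst hw
      exact Q.map_zero.le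
    · exact (hW w hw).le
  have hV' (v : V) : 0 ≤ Q (0, v, 0) := by
    by_cases hv : v = 0
    · subst hv
      exact Q.map_zero.ge
    · exact (hV v hv).le
  change Q (a, (s a).1, w) < 0
  -- The hypothesis `h` is applied at `w = (s a).2` and says nothing at the zero pair. There `a =
  -- 0`, and negativity in `w` alone is enough.
  by_cases h0 : (a, (s a).2) = 0
  · obtain ⟨ha, -⟩ := Prod.mk_eq_zero.mp h0
    subst ha
    have hw0 : w ≠ 0 := by
      rintro rfl
      exact haw rfl
    simpa using hW w hw0
  · obtain ⟨v, hv1⟩ := h _ _ h0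
    have := hV' (v - (s a).1)
    have := hW' (w - (s a).2)
    linarith [hv v]

theorem QuadraticForm.continuous_of_finiteDimensional {E : Type*} [NormedAddCommGroup E]
    [NormedSpace ℝ E] [FiniteDimensional ℝ E] (Q : QuadraticForm ℝ E) : Continuous Q := by
  let B : E →L[ℝ] E →L[ℝ] ℝ := LinearMap.toContinuousLinearMap
    (LinearMap.toContinuousLinearMap.toLinearMap ∘ₗ QuadraticMap.associated Q)
  have : (Q : E → ℝ) = fun x => B x x := by
    ext x
    simp [B, QuadraticMap.associated_eq_self_apply]
  rw [this]
  fun_prop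

/-- A negative definite form in finite dimension dominates a small multiple of any form. -/
theorem QuadraticForm.exists_pos_smul_add_nonpos {E : Type*} [NormedAddCommGroup E]
    [NormedSpace ℝ E] [FiniteDimensional ℝ E] (Q Q' : QuadraticForm ℝ E)
    (hQ : ∀ x, x ≠ 0 → Q x < 0) :
    ∃ ε : ℝ, 0 < ε ∧ ∀ ε', 0 ≤ ε' → ε' ≤ ε → ∀ x, x ≠ 0 → Q x + ε' * Q' x < 0 := by
  have hc := QuadraticForm.continuous_of_finiteDimensional Q
  have hc' := QuadraticForm.continuous_of_finiteDimensional Q'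
  have hK : IsCompact (Metric.sphere (0 : E) 1) := isCompact_sphere 0 1
  rcases (Metric.sphere (0 : E) 1).eq_empty_or_nonempty with hE | hE
  · refine ⟨1, one_pos, fun ε' _ _ x hx => ?_⟩
    have : ‖x‖⁻¹ • x ∈ Metric.sphere (0 : E) 1 := by
      simp [norm_smul, hx]
    simp [hE] at this
  obtain ⟨a, ha, hmax⟩ := hK.exists_isMaxOn hE hc.continuousOn
  obtain ⟨c, hc, hmax'⟩ := hK.exists_isMaxOn hE hc'.continuousOn
  have ha0 : Q a < 0 := hQ a (by rintro rfl; simp at ha)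
  -- On the unit sphere `Q ≤ Q a < 0` and `Q' ≤ |Q' c| + 1`; this constant uses up at most half of
  -- the margin `-Q a`. The `+ 1` keeps the denominator positive.
  refine ⟨-Q a / (2 * (|Q' c| + 1)), by have := abs_nonneg (Q' c); apply div_pos <;> linarith,
    fun ε' h0 h1 x hx => ?_⟩
  have hn : 0 < ‖x‖ := norm_pos_iff.mpr hx
  obtain ⟨y, hys, hxy⟩ : ∃ y ∈ Metric.sphere (0 : E) 1, x = ‖x‖ • y :=
    ⟨‖x‖⁻¹ • x, by simp [norm_smul, hx], by rw [smul_smul, mul_inv_cancel₀ hn.ne', one_smul]⟩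
  have h2 : Q y ≤ Q a := hmax hys
  have h3 : Q' y ≤ Q' c := hmax' hys
  have h4 : ε' * Q' y ≤ ε' * (|Q' c| + 1) :=
    mul_le_mul_of_nonneg_left (by linarith [le_abs_self (Q' c)]) h0
  have h5 : ε' * (|Q' c| + 1) ≤ -Q a / 2 := by
    have hp : 0 < |Q' c| + 1 := by positivity
    calc ε' * (|Q' c| + 1) ≤ -Q a / (2 * (|Q' c| + 1)) * (|Q' c| + 1) := by gcongr
      _ = -Q a / 2 := by field_simp
  have h6 : Q y + ε' * Q' y < 0 := by linarith
  have h7 : Q x + ε' * Q' x = ‖x‖ * ‖x‖ * (Q y + ε' * Q' y) := by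
    rw [congrArg Q hxy, congrArg Q' hxy, QuadraticMap.map_smul, QuadraticMap.map_smul,
      smul_eq_mul, smul_eq_mul]
    ring
  rw [h7]
  exact mul_neg_of_pos_of_neg (by positivity) h6

end QuadraticForms

/-! ### Matrix quadratic forms, Schur complements and duality. -/

section MatrixForms

open Matrix

variable {ι κ τ : Type*} [Fintype ι] [DecidableEq ι] [Fintype κ] [DecidableEq κ]
  [Fintype τ] [DecidableEq τ]

theorem Matrix.toQuadraticForm'_eq_dotProduct (M : Matrix ι ι ℝ) (v : ι → ℝ) :
    M.toQuadraticForm' v = v ⬝ᵥ M *ᵥ v := by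
  simp [Matrix.toQuadraticForm', Matrix.toLinearMap₂'_apply']

theorem Matrix.PosDef.toQuadraticForm'_pos {M : Matrix ι ι ℝ} (hM : M.PosDef) {v : ι → ℝ}
    (hv : v ≠ 0) : 0 < M.toQuadraticForm' v := by
  simpa [Matrix.toQuadraticForm'_eq_dotProduct] using hM.dotProduct_mulVec_pos hv

theorem Matrix.PosSemidef.toQuadraticForm'_nonneg {M : Matrix ι ι ℝ} (hM : M.PosSemidef)
    (v : ι → ℝ) : 0 ≤ M.toQuadraticForm' v := by
  simpa [Matrix.toQuadraticForm'_eq_dotProduct] using hM.dotProduct_mulVec_nonneg v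

theorem Matrix.smul_one_toQuadraticForm' (c : ℝ) (v : ι → ℝ) :
    (c • (1 : Matrix ι ι ℝ)).toQuadraticForm' v = c * v ⬝ᵥ v := by
  simp [Matrix.toQuadraticForm'_eq_dotProduct, smul_mulVec]

theorem Matrix.add_toQuadraticForm' (M N : Matrix ι ι ℝ) (v : ι → ℝ) :
    (M + N).toQuadraticForm' v = M.toQuadraticForm' v + N.toQuadraticForm' v := by
  simp [Matrix.toQuadraticForm'_eq_dotProduct, add_mulVec]

theorem Matrix.sub_toQuadraticForm' (M N : Matrix ι ι ℝ) (v : ι → ℝ) :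
    (M - N).toQuadraticForm' v = M.toQuadraticForm' v - N.toQuadraticForm' v := by
  simp [Matrix.toQuadraticForm'_eq_dotProduct, sub_mulVec]

theorem Matrix.neg_toQuadraticForm' (M : Matrix ι ι ℝ) (v : ι → ℝ) :
    (-M).toQuadraticForm' v = -M.toQuadraticForm' v := by
  simp [Matrix.toQuadraticForm'_eq_dotProduct, neg_mulVec]

theorem Matrix.transpose_mul_mul_toQuadraticForm' (M : Matrix ι ι ℝ) (N : Matrix ι κ ℝ)
    (v : κ → ℝ) : (Nᵀ * M * N).toQuadraticForm' v = M.toQuadraticForm' (N *ᵥ v) := by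
  simp [Matrix.toQuadraticForm'_eq_dotProduct, ← mulVec_mulVec, dotProduct_mulVec,
    vecMul_transpose]

theorem diag2_toQuadraticForm' (M : Matrix ι ι ℝ) (N : Matrix κ κ ℝ) (v : ι → ℝ) (w : κ → ℝ) :
    (diag2 M N).toQuadraticForm' (Sum.elim v w) = M.toQuadraticForm' v + N.toQuadraticForm' w := by
  simp [Matrix.toQuadraticForm'_eq_dotProduct, diag2, fromBlocks_mulVec]

theorem diag3_toQuadraticForm' (M : Matrix ι ι ℝ) (N : Matrix κ κ ℝ) (L : Matrix τ τ ℝ)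
    (v : ι → ℝ) (w : κ → ℝ) (x : τ → ℝ) :
    (diag3 M N L).toQuadraticForm' (Sum.elim v (Sum.elim w x)) =
      M.toQuadraticForm' v + N.toQuadraticForm' w + L.toQuadraticForm' x := by
  rw [diag3, diag2_toQuadraticForm', diag2_toQuadraticForm', add_assoc]

theorem diag2_mul_diag2 {α β : Type*} [Fintype α] [Fintype β] (A A' : Matrix α α ℝ)
    (B B' : Matrix β β ℝ) : diag2 A B * diag2 A' B' = diag2 (A * A') (B * B') := by
  simp [diag2, fromBlocks_multiply]

theorem diag2_one_one {α β : Type*} [DecidableEq α] [DecidableEq β] :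
    diag2 (1 : Matrix α α ℝ) (1 : Matrix β β ℝ) = 1 := fromBlocks_one

theorem Matrix.PosDef.diag2 {M : Matrix ι ι ℝ} {N : Matrix κ κ ℝ} (hM : M.PosDef)
    (hN : N.PosDef) : (diag2 M N).PosDef := by
  refine PosDef.of_dotProduct_mulVec_pos ?_ fun x hx => ?_
  · simp only [_root_.diag2, IsHermitian, fromBlocks_conjTranspose, hM.isHermitian.eq,
      hN.isHermitian.eq, conjTranspose_zero]
  · rw [star_trivial, ← toQuadraticForm'_eq_dotProduct, ← Sum.elim_comp_inl_inr x,
      diag2_toQuadraticForm']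
    have hM' := hM.posSemidef.toQuadraticForm'_nonneg (x ∘ Sum.inl)
    have hN' := hN.posSemidef.toQuadraticForm'_nonneg (x ∘ Sum.inr)
    by_cases h : x ∘ Sum.inl = 0
    · have h' : x ∘ Sum.inr ≠ 0 := by
        intro h'
        apply hx
        rw [← Sum.elim_comp_inl_inr x, h, h']
        ext (i | i) <;> rfl
      linarith [hN.toQuadraticForm'_pos h']
    · linarith [hM.toQuadraticForm'_pos h]

theorem Matrix.PosDef.mul_inv_self {M : Matrix ι ι ℝ} (hM : M.PosDef) : M * M⁻¹ = 1 :=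
  mul_nonsing_inv _ ((isUnit_iff_isUnit_det _).mp hM.isUnit)

theorem Matrix.PosDef.inv_mul_self {M : Matrix ι ι ℝ} (hM : M.PosDef) : M⁻¹ * M = 1 :=
  nonsing_inv_mul _ ((isUnit_iff_isUnit_det _).mp hM.isUnit)

/-- Evaluation of a block form at the vector that attains its Schur complement. -/
theorem Matrix.fromBlocks_toQuadraticForm'_schur {M : Matrix ι ι ℝ} {N : Matrix κ ι ℝ}
    {L : Matrix κ κ ℝ} (hL : L.PosDef) (v : ι → ℝ) :
    (fromBlocks M Nᵀ N L).toQuadraticForm' (Sum.elim v (-(L⁻¹ *ᵥ N *ᵥ v))) =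
      M.toQuadraticForm' v - (L⁻¹).toQuadraticForm' (N *ᵥ v) := by
  have h1 : L *ᵥ L⁻¹ *ᵥ N *ᵥ v = N *ᵥ v := by
    rw [mulVec_mulVec, hL.mul_inv_self, one_mulVec]
  have h2 : v ⬝ᵥ Nᵀ *ᵥ L⁻¹ *ᵥ N *ᵥ v = N *ᵥ v ⬝ᵥ L⁻¹ *ᵥ N *ᵥ v := by
    rw [dotProduct_mulVec, vecMul_transpose]
  simp only [toQuadraticForm'_eq_dotProduct, fromBlocks_mulVec, Sum.elim_comp_inl,
    Sum.elim_comp_inr, sumElim_dotProduct_sumElim, dotProduct_add, mulVec_neg, dotProduct_neg,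
    h1, h2]
  ring_nf

theorem Matrix.PosDef.toQuadraticForm'_schur_lt {M : Matrix ι ι ℝ} {N : Matrix κ ι ℝ}
    {L : Matrix κ κ ℝ} (h : (fromBlocks M Nᵀ N L).PosDef) (hL : L.PosDef) {v : ι → ℝ}
    (hv : v ≠ 0) : (L⁻¹).toQuadraticForm' (N *ᵥ v) < M.toQuadraticForm' v := by
  have := h.toQuadraticForm'_pos (v := Sum.elim v (-(L⁻¹ *ᵥ N *ᵥ v))) (by
    intro h0
    exact hv (funext fun i => congrFun h0 (Sum.inl i)))
  rw [fromBlocks_toQuadraticForm'_schur hL] at this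
  linarith

theorem Matrix.PosSemidef.toQuadraticForm'_schur_le {M : Matrix ι ι ℝ} {N : Matrix κ ι ℝ}
    {L : Matrix κ κ ℝ} (h : (fromBlocks M Nᵀ N L).PosSemidef) (hL : L.PosDef) (v : ι → ℝ) :
    (L⁻¹).toQuadraticForm' (N *ᵥ v) ≤ M.toQuadraticForm' v := by
  have := h.toQuadraticForm'_nonneg (Sum.elim v (-(L⁻¹ *ᵥ N *ᵥ v)))
  rw [fromBlocks_toQuadraticForm'_schur hL] at this
  linarith

/-- Every vector has a decomposition `x + B u` orthogonal to the columns of `B`. -/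
theorem Matrix.PosDef.exists_transpose_mulVec_eq_zero {ν : Type*} [Fintype ν]
    {M : Matrix ι ι ℝ} (hM : M.PosDef) (B : Matrix ι ν ℝ) (x : ι → ℝ) : ∃ u, Bᵀ *ᵥ M *ᵥ (x + B *ᵥ u) = 0 := by
  -- `B` need not be injective, so the normal equations are solved on its range, where `M` is still
  -- positive definite and hence nondegenerate.
  let V := LinearMap.range B.mulVecLin
  let Φ : V →ₗ[ℝ] Module.Dual ℝ V := (toLinearMap₂' ℝ M).compl₁₂ V.subtype V.subtype
  have hΦ : Function.Injective Φ := by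
    rw [injective_iff_map_eq_zero]
    intro v hv
    by_contra hv0
    have h1 : (v : ι → ℝ) ⬝ᵥ M *ᵥ v = 0 := by
      simpa [Φ, toLinearMap₂'_apply'] using DFunLike.congr_fun hv v
    have h2 := hM.toQuadraticForm'_pos (v := v) (by simpa using hv0)
    rw [toQuadraticForm'_eq_dotProduct] at h2
    linarith
  let e := LinearMap.linearEquivOfInjective Φ hΦ Subspace.dual_finrank_eq.symm
  let f : Module.Dual ℝ V := -((toLinearMap₂' ℝ M x) ∘ₗ V.subtype)
  obtain ⟨⟨_, u, rfl⟩, hu⟩ := e.surjective f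
  refine ⟨u, ?_⟩
  have hMT : Mᵀ = M := by simpa [IsHermitian] using hM.isHermitian
  apply dotProduct_eq_zero
  intro w
  have h1 := DFunLike.congr_fun hu ⟨B *ᵥ w, w, rfl⟩
  replace h1 : B *ᵥ u ⬝ᵥ M *ᵥ B *ᵥ w = -(x ⬝ᵥ M *ᵥ B *ᵥ w) := by
    simpa only [e, f, Φ, LinearMap.linearEquivOfInjective_apply, LinearMap.compl₁₂_apply,
      LinearMap.neg_apply, LinearMap.comp_apply, Submodule.subtype_apply, toLinearMap₂'_apply',
      mulVecLin_apply] using h1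
  have h2 : (Bᵀ *ᵥ M *ᵥ (x + B *ᵥ u)) ⬝ᵥ w = (x + B *ᵥ u) ⬝ᵥ M *ᵥ B *ᵥ w := by
    rw [mulVec_transpose, ← dotProduct_mulVec, dotProduct_mulVec (x + B *ᵥ u), ← mulVec_transpose,
      hMT]
  rw [h2, add_dotProduct, h1]
  ring

/-- Dual form of the solvability of `‖H x + B u‖_{P⁻¹} < ‖x‖_{M⁻¹}` for `u`. -/
theorem Matrix.exists_toQuadraticForm'_lt_of_dual {ν : Type*} [Fintype ν]
    {P P' : Matrix ι ι ℝ} {M M' : Matrix κ κ ℝ}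
    (hP : P * P' = 1) (hP' : P'.PosDef) (hM : M' * M = 1) (hM' : M'.PosDef)
    (H : Matrix ι κ ℝ) (B : Matrix ι ν ℝ)
    (h : ∀ y, y ≠ 0 → Bᵀ *ᵥ y = 0 → M.toQuadraticForm' (Hᵀ *ᵥ y) < P.toQuadraticForm' y)
    (x : κ → ℝ) (hx : x ≠ 0) :
    ∃ u, P'.toQuadraticForm' (H *ᵥ x + B *ᵥ u) < M'.toQuadraticForm' x := by
  -- The minimizing `u` makes `y = P' ρ` satisfy `Bᵀ y = 0`, so the dual hypothesis applies to `y`,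
  -- and `P(y) = P'(ρ) = ⟨Hᵀ y, x⟩`.
  obtain ⟨u, hu⟩ := hP'.exists_transpose_mulVec_eq_zero B (H *ᵥ x)
  refine ⟨u, ?_⟩
  set ρ := H *ᵥ x + B *ᵥ u with hρ
  set y := P' *ᵥ ρ with hy
  have hPy : P *ᵥ y = ρ := by rw [hy, mulVec_mulVec, hP, one_mulVec]
  have h1 : P'.toQuadraticForm' ρ = Hᵀ *ᵥ y ⬝ᵥ x := by
    have : B *ᵥ u ⬝ᵥ y = 0 := by
      rw [dotProduct_comm, dotProduct_mulVec, ← mulVec_transpose, hu, zero_dotProduct]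
    rw [toQuadraticForm'_eq_dotProduct, ← hy, hρ, add_dotProduct, this, add_zero,
      dotProduct_comm, dotProduct_mulVec, ← mulVec_transpose]
  have h2 : P.toQuadraticForm' y = P'.toQuadraticForm' ρ := by
    rw [toQuadraticForm'_eq_dotProduct, toQuadraticForm'_eq_dotProduct, hPy, ← hy,
      dotProduct_comm]
  by_cases hy0 : y = 0
  · rw [toQuadraticForm'_eq_dotProduct, ← hy, hy0, dotProduct_zero]
    exact hM'.toQuadraticForm'_pos hx
  · have h3 := h y hy0 hu
    set η := Hᵀ *ᵥ y with hη
    -- Completing the square gives `2⟨η, x⟩ ≤ M'(x) + M(η)`. Since `M(η) < P(y) = ⟨η, x⟩ = P'(ρ)`,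
    -- the claim follows.
    have h4 := hM'.posSemidef.toQuadraticForm'_nonneg (x - M *ᵥ η)
    have hMT : M'ᵀ = M' := by simpa [IsHermitian] using hM'.isHermitian
    have h5 : M' *ᵥ M *ᵥ η = η := by rw [mulVec_mulVec, hM, one_mulVec]
    have h6 : M *ᵥ η ⬝ᵥ M' *ᵥ x = η ⬝ᵥ x := by
      rw [dotProduct_mulVec, ← mulVec_transpose, hMT, h5]
    rw [toQuadraticForm'_eq_dotProduct, mulVec_sub, h5, sub_dotProduct, dotProduct_sub,
      dotProduct_sub, h6, dotProduct_comm x η, dotProduct_comm (M *ᵥ η) η,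
      ← toQuadraticForm'_eq_dotProduct, ← toQuadraticForm'_eq_dotProduct] at h4
    linarith

end MatrixForms

/-! ### From the dissipation form to a static gain. -/

section Synthesis

open Matrix

variable {n nb p : ℕ} {m : Fin p → ℕ} {nd ne nu : ℕ}

def LFTPlant.nextState (G : LFTPlant n nb m nd ne nu) (z : StateIdx n nb → ℝ)
    (θ : ChanIdx m → ℝ) (d : Fin nd → ℝ) (u : Fin nu → ℝ) : StateIdx n nb → ℝ :=
  G.Ass.mulVec z + G.Asp.mulVec θ + G.B1s.mulVec d + G.B2s.mulVec u

def LFTPlant.channelOut (G : LFTPlant n nb m nd ne nu) (z : StateIdx n nb → ℝ)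
    (θ : ChanIdx m → ℝ) (d : Fin nd → ℝ) (u : Fin nu → ℝ) : ChanIdx m → ℝ :=
  G.Aps.mulVec z + G.App.mulVec θ + G.B1p.mulVec d + G.B2p.mulVec u

def LFTPlant.perfOut (G : LFTPlant n nb m nd ne nu) (z : StateIdx n nb → ℝ)
    (θ : ChanIdx m → ℝ) (d : Fin nd → ℝ) (u : Fin nu → ℝ) : Fin ne → ℝ :=
  G.C1s.mulVec z + G.C1p.mulVec θ + G.D11.mulVec d + G.D12.mulVec u

theorem LFTPlant.H_mulVec (G : LFTPlant n nb m nd ne nu) (z : StateIdx n nb → ℝ)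
    (θ : ChanIdx m → ℝ) (d : Fin nd → ℝ) (u : Fin nu → ℝ) :
    G.H *ᵥ Sum.elim z (Sum.elim θ d) + G.ctrlRowᵀ *ᵥ u =
      Sum.elim (G.nextState z θ d u) (Sum.elim (G.channelOut z θ d u) (G.perfOut z θ d u)) := by
  ext (i | i | i) <;>
    simp [LFTPlant.H, LFTPlant.H12, LFTPlant.H21, LFTPlant.H22, LFTPlant.ctrlRow,
      fromBlocks_mulVec, fromRows_mulVec, transpose_fromCols,
      LFTPlant.nextState, LFTPlant.channelOut, LFTPlant.perfOut] <;> ring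

theorem LFTPlant.H12_mulVec (G : LFTPlant n nb m nd ne nu)
    (θ : ChanIdx m → ℝ) (d : Fin nd → ℝ) :
    G.H12 *ᵥ Sum.elim θ d = G.nextState 0 θ d 0 := by
  simp [LFTPlant.H12, LFTPlant.nextState]

theorem LFTPlant.H22_mulVec (G : LFTPlant n nb m nd ne nu)
    (θ : ChanIdx m → ℝ) (d : Fin nd → ℝ) :
    G.H22 *ᵥ Sum.elim θ d = Sum.elim (G.channelOut 0 θ d 0) (G.perfOut 0 θ d 0) := by
  simp [LFTPlant.H22, fromBlocks_mulVec, LFTPlant.channelOut, LFTPlant.perfOut]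

/-- Signals `(z, θ, θc, d, φc, u)` of the plant with a controller having the plant's channels. -/
abbrev StepSignals (n nb : ℕ) {p : ℕ} (m : Fin p → ℕ) (nd nu : ℕ) : Type :=
  (StateIdx n nb → ℝ) × (ChanIdx m → ℝ) × (ChanIdx m → ℝ) × (Fin nd → ℝ) × (ChanIdx m → ℝ) ×
    (Fin nu → ℝ)

def LFTPlant.nextStateLin (G : LFTPlant n nb m nd ne nu) :
    StepSignals n nb m nd nu →ₗ[ℝ] (StateIdx n nb → ℝ) where
  toFun x := G.nextState x.1 x.2.1 x.2.2.2.1 x.2.2.2.2.2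
  map_add' x y := by simp [LFTPlant.nextState, mulVec_add]; abel
  map_smul' c x := by simp [LFTPlant.nextState, mulVec_smul]

def LFTPlant.channelOutLin (G : LFTPlant n nb m nd ne nu) :
    StepSignals n nb m nd nu →ₗ[ℝ] (ChanIdx m → ℝ) where
  toFun x := G.channelOut x.1 x.2.1 x.2.2.2.1 x.2.2.2.2.2
  map_add' x y := by simp [LFTPlant.channelOut, mulVec_add]; abel
  map_smul' c x := by simp [LFTPlant.channelOut, mulVec_smul]

def LFTPlant.perfOutLin (G : LFTPlant n nb m nd ne nu) :
    StepSignals n nb m nd nu →ₗ[ℝ] (Fin ne → ℝ) where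
  toFun x := G.perfOut x.1 x.2.1 x.2.2.2.1 x.2.2.2.2.2
  map_add' x y := by simp [LFTPlant.perfOut, mulVec_add]; abel
  map_smul' c x := by simp [LFTPlant.perfOut, mulVec_smul]

/-- Increase of the storage plus the weighted channel and performance outputs, minus the
weighted channel and disturbance inputs. -/
noncomputable def LFTPlant.dissipationForm (G : LFTPlant n nb m nd ne nu)
    (Xp X : Matrix (StateIdx n nb) (StateIdx n nb) ℝ) (Y T : Matrix (ChanIdx m) (ChanIdx m) ℝ)
    (b f : ℝ) : QuadraticForm ℝ (StepSignals n nb m nd nu) :=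
  Xp.toQuadraticForm'.comp G.nextStateLin + Y.toQuadraticForm'.comp G.channelOutLin
    + T.toQuadraticForm'.comp (G.channelOutLin - LinearMap.fst ℝ _ _ ∘ₗ LinearMap.snd ℝ _ _ ∘ₗ
      LinearMap.snd ℝ _ _ ∘ₗ LinearMap.snd ℝ _ _ ∘ₗ LinearMap.snd ℝ _ _)
    + b⁻¹ • (1 : Matrix (Fin ne) (Fin ne) ℝ).toQuadraticForm'.comp G.perfOutLin
    - X.toQuadraticForm'.comp (LinearMap.fst ℝ _ _)
    - Y.toQuadraticForm'.comp (LinearMap.fst ℝ _ _ ∘ₗ LinearMap.snd ℝ _ _)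
    - T.toQuadraticForm'.comp (LinearMap.fst ℝ _ _ ∘ₗ LinearMap.snd ℝ _ _
      - LinearMap.fst ℝ _ _ ∘ₗ LinearMap.snd ℝ _ _ ∘ₗ LinearMap.snd ℝ _ _)
    - f • (1 : Matrix (Fin nd) (Fin nd) ℝ).toQuadraticForm'.comp (LinearMap.fst ℝ _ _ ∘ₗ
      LinearMap.snd ℝ _ _ ∘ₗ LinearMap.snd ℝ _ _ ∘ₗ LinearMap.snd ℝ _ _)

theorem LFTPlant.dissipationForm_apply (G : LFTPlant n nb m nd ne nu)
    (Xp X : Matrix (StateIdx n nb) (StateIdx n nb) ℝ) (Y T : Matrix (ChanIdx m) (ChanIdx m) ℝ)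
    (b f : ℝ) (z : StateIdx n nb → ℝ) (θ θc : ChanIdx m → ℝ) (d : Fin nd → ℝ)
    (φc : ChanIdx m → ℝ) (u : Fin nu → ℝ) :
    G.dissipationForm Xp X Y T b f (z, θ, θc, d, φc, u) =
      Xp.toQuadraticForm' (G.nextState z θ d u) + Y.toQuadraticForm' (G.channelOut z θ d u)
        + T.toQuadraticForm' (G.channelOut z θ d u - φc)
        + b⁻¹ * (G.perfOut z θ d u ⬝ᵥ G.perfOut z θ d u)
        - X.toQuadraticForm' z - Y.toQuadraticForm' θ - T.toQuadraticForm' (θ - θc)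
        - f * (d ⬝ᵥ d) := by
  have h1 {ι : Type} [Fintype ι] [DecidableEq ι] (v : ι → ℝ) :
      (1 : Matrix ι ι ℝ).toQuadraticForm' v = v ⬝ᵥ v := by
    rw [toQuadraticForm'_eq_dotProduct, one_mulVec]
  simp [LFTPlant.dissipationForm, LFTPlant.nextStateLin, LFTPlant.channelOutLin,
    LFTPlant.perfOutLin, h1]

/-- A static LFT gain rendering the closed loop strictly dissipative, for a storage function
with next value `Xp` and current value `X`, and for the scaling
`(θ, θc) ↦ θᵀ Y θ + (θ - θc)ᵀ T (θ - θc)`. The first hypothesis is solvability by a control that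
knows all signals, the second is dissipativity from the unmeasured signals. -/
theorem LFTPlant.exists_dissipative_gain (G : LFTPlant n nb m nd ne nu)
    {Xp X : Matrix (StateIdx n nb) (StateIdx n nb) ℝ} {Y T : Matrix (ChanIdx m) (ChanIdx m) ℝ}
    {b f : ℝ} (hXp : Xp.PosDef) (hY : Y.PosDef) (hT : T.PosDef) (hb : 0 < b)
    (hfull : ∀ z θ d, (z, θ, d) ≠ 0 → ∃ u,
      Xp.toQuadraticForm' (G.nextState z θ d u) + Y.toQuadraticForm' (G.channelOut z θ d u)
        + b⁻¹ * (G.perfOut z θ d u ⬝ᵥ G.perfOut z θ d u)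
      < X.toQuadraticForm' z + Y.toQuadraticForm' θ + f * (d ⬝ᵥ d))
    (hdist : ∀ θ d, (θ, d) ≠ 0 →
      Xp.toQuadraticForm' (G.nextState 0 θ d 0) + Y.toQuadraticForm' (G.channelOut 0 θ d 0)
        + T.toQuadraticForm' (G.channelOut 0 θ d 0)
        + b⁻¹ * (G.perfOut 0 θ d 0 ⬝ᵥ G.perfOut 0 θ d 0)
      < Y.toQuadraticForm' θ + T.toQuadraticForm' θ + f * (d ⬝ᵥ d)) :
    ∃ (Ac : Matrix (ChanIdx m) (ChanIdx m) ℝ) (Bc : Matrix (ChanIdx m) (StateIdx n nb) ℝ)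
      (Cc : Matrix (Fin nu) (ChanIdx m) ℝ) (Dc : Matrix (Fin nu) (StateIdx n nb) ℝ) (ε : ℝ),
      0 < ε ∧ ∀ ε', 0 ≤ ε' → ε' ≤ ε → ∀ z θ θc d, (z, θ, θc, d) ≠ 0 →
        G.dissipationForm Xp X Y T b f
          (z, θ, θc, d, Ac *ᵥ θc + Bc *ᵥ z, Cc *ᵥ θc + Dc *ᵥ z)
          + ε' * X.toQuadraticForm' z < 0 := by
  let B : (Fin nu → ℝ) →ₗ[ℝ] (StateIdx n nb → ℝ) × (ChanIdx m → ℝ) × (Fin ne → ℝ) :=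
    G.B2s.mulVecLin.prod (G.B2p.mulVecLin.prod G.D12.mulVecLin)
  -- Controls in the kernel of `B` have no effect on the plant, so the form is only semidefinite in
  -- `u`. Restricting to a complement `U` restores strict positivity without losing any plant
  -- response.
  obtain ⟨U, hU⟩ := B.ker.exists_isCompl
  have hproj (u : Fin nu → ℝ) : ∃ v : U, B v = B u := by
    have : u ∈ B.ker ⊔ U := by rw [hU.sup_eq_top]; trivial
    obtain ⟨w, hw, v, hv, rfl⟩ := Submodule.mem_sup.mp this
    exact ⟨⟨v, hv⟩, by simp [LinearMap.mem_ker.mp hw]⟩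
  have hinj (v : U) (hv : B v = 0) : v = 0 := by
    have : (v : Fin nu → ℝ) ∈ B.ker ⊓ U := ⟨hv, v.2⟩
    rw [hU.inf_eq_bot] at this
    simpa using this
  have hF (z θ d) (u u' : Fin nu → ℝ) (h : B u = B u') :
      G.nextState z θ d u = G.nextState z θ d u' ∧ G.channelOut z θ d u = G.channelOut z θ d u' ∧
        G.perfOut z θ d u = G.perfOut z θ d u' := by
    have h1 : G.B2s *ᵥ u = G.B2s *ᵥ u' := congrArg Prod.fst h
    have h2 : G.B2p *ᵥ u = G.B2p *ᵥ u' := congrArg (fun x => x.2.1) h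
    have h3 : G.D12 *ᵥ u = G.D12 *ᵥ u' := congrArg (fun x => x.2.2) h
    simp [LFTPlant.nextState, LFTPlant.channelOut, LFTPlant.perfOut, h1, h2, h3]
  -- Regroups the signals by role: measured `(z, θc)`, chosen `(φc, u)`, unmeasured `(θ, d)`.
  let ρ : ((StateIdx n nb → ℝ) × (ChanIdx m → ℝ)) × ((ChanIdx m → ℝ) × U) ×
      ((ChanIdx m → ℝ) × (Fin nd → ℝ)) →ₗ[ℝ] _ :=
    { toFun := fun x => ((x.1.1, x.2.2.1, x.1.2, x.2.2.2, x.2.1.1, x.2.1.2) :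
        (StateIdx n nb → ℝ) × (ChanIdx m → ℝ) × (ChanIdx m → ℝ) × (Fin nd → ℝ) ×
          (ChanIdx m → ℝ) × (Fin nu → ℝ))
      map_add' := fun _ _ => rfl
      map_smul' := fun _ _ => rfl }
  have hY0 (x) : 0 ≤ Y.toQuadraticForm' x := hY.posSemidef.toQuadraticForm'_nonneg x
  have hT0 (x) : 0 ≤ T.toQuadraticForm' x := hT.posSemidef.toQuadraticForm'_nonneg x
  have hX0 (x) : 0 ≤ Xp.toQuadraticForm' x := hXp.posSemidef.toQuadraticForm'_nonneg x
  have hb' : 0 < b⁻¹ := inv_pos.mpr hb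
  have hd0 {ι : Type} [Fintype ι] (x : ι → ℝ) : 0 ≤ x ⬝ᵥ x := by
    simpa using dotProduct_star_self_nonneg x
  obtain ⟨K, hK⟩ := exists_linear_saddle_strategy ((G.dissipationForm Xp X Y T b f).comp ρ)
    (by
      rintro ⟨φc, u⟩ hv
      by_contra hneg
      simp only [QuadraticMap.comp_apply, ρ, LinearMap.coe_mk, AddHom.coe_mk, Prod.fst_zero,
        Prod.snd_zero, LFTPlant.dissipationForm_apply, sub_self, QuadraticMap.map_zero,
        dotProduct_zero, mul_zero, sub_zero] at hneg
      have h1 := hX0 (G.nextState 0 0 0 u)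
      have h2 := hY0 (G.channelOut 0 0 0 u)
      have h3 := hT0 (G.channelOut 0 0 0 u - φc)
      have h4 := mul_nonneg hb'.le (hd0 (G.perfOut 0 0 0 u))
      have e1 : G.nextState 0 0 0 u = 0 := by
        by_contra h
        linarith [hXp.toQuadraticForm'_pos h]
      have e2 : G.channelOut 0 0 0 u = 0 := by
        by_contra h
        linarith [hY.toQuadraticForm'_pos h]
      have e3 : G.channelOut 0 0 0 u - φc = 0 := by
        by_contra h
        linarith [hT.toQuadraticForm'_pos h]
      have e4 : G.perfOut 0 0 0 u = 0 := by
        have : b⁻¹ * (G.perfOut 0 0 0 u ⬝ᵥ G.perfOut 0 0 0 u) = 0 := by linarith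
        simpa [hb.ne'] using this
      have hu : u = 0 := hinj u (by
        simpa [B, LFTPlant.nextState, LFTPlant.channelOut, LFTPlant.perfOut] using
          (show (_ ∧ _ ∧ _) from ⟨e1, e2, e4⟩))
      rw [e2, zero_sub, neg_eq_zero] at e3
      exact hv (by rw [hu, e3]; rfl))
    (by
      rintro ⟨θ, d⟩ hw
      have := hdist θ d hw
      simp only [QuadraticMap.comp_apply, ρ, LinearMap.coe_mk, AddHom.coe_mk, Prod.fst_zero,
        Prod.snd_zero, LFTPlant.dissipationForm_apply, QuadraticMap.map_zero, sub_zero,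
        Submodule.coe_zero]
      linarith)
    (by
      rintro ⟨z, θc⟩ ⟨θ, d⟩ hne
      simp only [QuadraticMap.comp_apply, ρ, LinearMap.coe_mk, AddHom.coe_mk,
        LFTPlant.dissipationForm_apply]
      -- If only `θc` is nonzero, the full-information hypothesis is void, but the zero choice
      -- already leaves `-T(θc) < 0`.
      by_cases h0 : (z, θ, d) = 0
      · simp only [Prod.mk_eq_zero] at h0 hne
        obtain ⟨rfl, rfl, rfl⟩ := h0
        have hθc : -θc ≠ 0 := by simpa using hne
        refine ⟨0, ?_⟩
        have := hT.toQuadraticForm'_pos hθc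
        simp [LFTPlant.nextState, LFTPlant.channelOut, LFTPlant.perfOut] at this ⊢
        linarith
      · obtain ⟨u, hu⟩ := hfull z θ d h0
        obtain ⟨v, hv⟩ := hproj u
        obtain ⟨e1, e2, e3⟩ := hF z θ d v u hv
        -- With full information the controller channel can copy the plant channel, which removes
        -- the positive `T`-term.
        refine ⟨(G.channelOut z θ d u, v), ?_⟩
        rw [e1, e2, e3, sub_self, QuadraticMap.map_zero]
        have := hT0 (θ - θc)
        linarith)
  let K₁ : (StateIdx n nb → ℝ) × (ChanIdx m → ℝ) →ₗ[ℝ] (ChanIdx m → ℝ) :=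
    LinearMap.fst ℝ _ _ ∘ₗ K
  let K₂ : (StateIdx n nb → ℝ) × (ChanIdx m → ℝ) →ₗ[ℝ] (Fin nu → ℝ) :=
    U.subtype ∘ₗ LinearMap.snd ℝ _ _ ∘ₗ K
  let σ : (StateIdx n nb → ℝ) × (ChanIdx m → ℝ) × (ChanIdx m → ℝ) × (Fin nd → ℝ) →ₗ[ℝ] _ :=
    { toFun := fun x => (((x.1, x.2.2.1), K (x.1, x.2.2.1), (x.2.1, x.2.2.2)) :
        ((StateIdx n nb → ℝ) × (ChanIdx m → ℝ)) × ((ChanIdx m → ℝ) × U) ×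
          ((ChanIdx m → ℝ) × (Fin nd → ℝ)))
      map_add' := fun x y => by
        simp only [Prod.fst_add, Prod.snd_add, ← Prod.mk_add_mk, map_add]
      map_smul' := fun c x => by
        simp only [Prod.smul_fst, Prod.smul_snd, ← Prod.smul_mk, map_smul, RingHom.id_apply] }
  obtain ⟨ε, hε, hQ⟩ := QuadraticForm.exists_pos_smul_add_nonpos
    (((G.dissipationForm Xp X Y T b f).comp ρ).comp σ)
    (X.toQuadraticForm'.comp (LinearMap.fst ℝ _ _)) (by
      rintro ⟨z, θ, θc, d⟩ hx
      refine hK (z, θc) (θ, d) fun h => hx ?_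
      simp only [Prod.mk_eq_zero] at h ⊢
      tauto)
  have hsplit {ι : Type} (L : (StateIdx n nb → ℝ) × (ChanIdx m → ℝ) →ₗ[ℝ] (ι → ℝ)) (z θc) :
      LinearMap.toMatrix' (L ∘ₗ LinearMap.inr ℝ _ _) *ᵥ θc +
        LinearMap.toMatrix' (L ∘ₗ LinearMap.inl ℝ _ _) *ᵥ z = L (z, θc) := by
    rw [LinearMap.toMatrix'_mulVec, LinearMap.toMatrix'_mulVec, LinearMap.comp_apply,
      LinearMap.comp_apply, ← map_add]
    simp
  refine ⟨LinearMap.toMatrix' (K₁ ∘ₗ LinearMap.inr ℝ _ _),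
    LinearMap.toMatrix' (K₁ ∘ₗ LinearMap.inl ℝ _ _),
    LinearMap.toMatrix' (K₂ ∘ₗ LinearMap.inr ℝ _ _),
    LinearMap.toMatrix' (K₂ ∘ₗ LinearMap.inl ℝ _ _), ε, hε, fun ε' h0 h1 z θ θc d hx => ?_⟩
  rw [hsplit, hsplit]
  exact hQ ε' h0 h1 (z, θ, θc, d) hx

end Synthesis

/-! ### Block-diagonal scalings and the scheduling block. -/

section Channels

open Matrix

variable {p : ℕ} {m : Fin p → ℕ}

theorem blockDiagonal'_mulVec_apply (Y : ∀ i, Matrix (Fin (m i)) (Fin (m i)) ℝ)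
    (v : ChanIdx m → ℝ) (i : Fin p) (j : Fin (m i)) :
    (blockDiagonal' Y *ᵥ v) ⟨i, j⟩ = (Y i *ᵥ fun l => v ⟨i, l⟩) j := by
  rw [mulVec, dotProduct, Fintype.sum_sigma, Finset.sum_eq_single i]
  · simp [mulVec, dotProduct, blockDiagonal'_apply_eq]
  · intro i' _ hi'
    exact Finset.sum_eq_zero fun l _ => by rw [blockDiagonal'_apply_ne _ _ _ hi'.symm, zero_mul]
  · simp

theorem blockDiagonal'_toQuadraticForm' (Y : ∀ i, Matrix (Fin (m i)) (Fin (m i)) ℝ)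
    (v : ChanIdx m → ℝ) :
    (blockDiagonal' Y).toQuadraticForm' v = ∑ i, (Y i).toQuadraticForm' fun j => v ⟨i, j⟩ := by
  rw [toQuadraticForm'_eq_dotProduct, dotProduct, Fintype.sum_sigma]
  refine Finset.sum_congr rfl fun i _ => ?_
  rw [toQuadraticForm'_eq_dotProduct, dotProduct]
  simp only [blockDiagonal'_mulVec_apply]

theorem Matrix.PosDef.blockDiagonal' {Y : ∀ i, Matrix (Fin (m i)) (Fin (m i)) ℝ}
    (hY : ∀ i, (Y i).PosDef) : (blockDiagonal' Y).PosDef := by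
  refine PosDef.of_dotProduct_mulVec_pos ?_ fun x hx => ?_
  · rw [IsHermitian, blockDiagonal'_conjTranspose]
    congr 1
    ext i : 1
    exact (hY i).isHermitian
  · rw [star_trivial, ← toQuadraticForm'_eq_dotProduct, blockDiagonal'_toQuadraticForm']
    obtain ⟨⟨i, j⟩, hij⟩ := Function.ne_iff.mp hx
    refine Finset.sum_pos' (fun i _ => (hY i).posSemidef.toQuadraticForm'_nonneg _)
      ⟨i, Finset.mem_univ _, (hY i).toQuadraticForm'_pos ?_⟩
    exact Function.ne_iff.mpr ⟨j, hij⟩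

theorem schedMatrix_mulVec_apply (δ : Fin p → ℝ) (v : ChanIdx m → ℝ) (i : Fin p)
    (j : Fin (m i)) : (schedMatrix m δ *ᵥ v) ⟨i, j⟩ = δ i * v ⟨i, j⟩ := by
  rw [schedMatrix, blockDiagonal'_mulVec_apply, smul_mulVec, one_mulVec]
  rfl

/-- Structured scalings do not increase under an admissible scheduling block. -/
theorem toQuadraticForm'_schedMatrix_le {Y : ∀ i, Matrix (Fin (m i)) (Fin (m i)) ℝ}
    (hY : ∀ i, (Y i).PosSemidef) {δ : Fin p → ℝ} (hδ : ∀ i, |δ i| ≤ 1) (v : ChanIdx m → ℝ) :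
    (blockDiagonal' Y).toQuadraticForm' (schedMatrix m δ *ᵥ v) ≤
      (blockDiagonal' Y).toQuadraticForm' v := by
  rw [blockDiagonal'_toQuadraticForm', blockDiagonal'_toQuadraticForm']
  refine Finset.sum_le_sum fun i _ => ?_
  have h1 : (fun j => (schedMatrix m δ *ᵥ v) ⟨i, j⟩) = δ i • fun j => v ⟨i, j⟩ := by
    ext j
    rw [schedMatrix_mulVec_apply]
    rfl
  rw [h1, QuadraticMap.map_smul, smul_eq_mul]
  have h2 : δ i * δ i ≤ 1 := by
    rw [← abs_mul_abs_self]
    exact mul_le_one₀ (hδ i) (abs_nonneg _) (hδ i)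
  exact mul_le_of_le_one_left ((hY i).toQuadraticForm'_nonneg _) h2

end Channels

/-! ### Reading the matrix inequalities as the two solvability conditions. -/

section LinearMatrixInequalities

open Matrix

variable {n nb p : ℕ} {m : Fin p → ℕ} {nd ne nu : ℕ}

theorem inv_le_of_fromBlocks_posSemidef {ι : Type*} [Fintype ι] [DecidableEq ι]
    {R S : Matrix ι ι ℝ} (hR : R.PosDef) (h : (fromBlocks R 1 1 S).PosSemidef) (v : ι → ℝ) :
    (R⁻¹).toQuadraticForm' v ≤ S.toQuadraticForm' v := by
  have h' := h.submatrix Sum.swap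
  rw [fromBlocks_submatrix_sum_swap_sum_swap] at h'
  have h'' : (fromBlocks S (1 : Matrix ι ι ℝ)ᵀ 1 R).PosSemidef := by rwa [transpose_one]
  simpa using h''.toQuadraticForm'_schur_le hR v

theorem inv_le_of_posSemidef_fin_two {x y : ℝ} (hy : 0 < y)
    (h : (!![x, 1; 1, y] : Matrix (Fin 2) (Fin 2) ℝ).PosSemidef) : y⁻¹ ≤ x := by
  have := h.dotProduct_mulVec_nonneg ![1, -y⁻¹]
  simp [Matrix.mulVec, dotProduct, Fin.sum_univ_two, hy.ne'] at this
  linarith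

/-- The columns of `NR` span the kernel of `[B₂ₛᵀ B₂ₚᵀ D₁₂ᵀ]`, so the `R`-inequality is exactly the
dual condition of `Matrix.exists_toQuadraticForm'_lt_of_dual` for the map `H` and the input matrix
`ctrlRowᵀ`. Dualizing inverts all the weights. -/
theorem LFTPlant.exists_full_information_control (G : LFTPlant n nb m nd ne nu) {r : ℕ}
    {NR : Matrix (StateIdx n nb ⊕ (ChanIdx m ⊕ Fin ne)) (Fin r) ℝ}
    (hNR : LinearMap.range NR.mulVecLin = LinearMap.ker G.ctrlRow.mulVecLin)
    {X Xp : Matrix (StateIdx n nb) (StateIdx n nb) ℝ} {R : Matrix (ChanIdx m) (ChanIdx m) ℝ}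
    {R' : Matrix (ChanIdx m) (ChanIdx m) ℝ} {b g : ℝ}
    (hX : X.PosDef) (hXp : Xp.PosDef) (hRR : R * R' = 1) (hR' : R'.PosDef)
    (hb : 0 < b) (hg : 0 < g)
    (hLMI : (-(NRᵀ * (G.H * diag3 X R (g • (1 : Matrix (Fin nd) (Fin nd) ℝ)) * G.Hᵀ
          - diag3 Xp R (b • (1 : Matrix (Fin ne) (Fin ne) ℝ))) * NR)).PosDef)
    (z : StateIdx n nb → ℝ) (θ : ChanIdx m → ℝ) (d : Fin nd → ℝ) (hne : (z, θ, d) ≠ 0) :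
    ∃ u, (Xp⁻¹).toQuadraticForm' (G.nextState z θ d u)
        + R'.toQuadraticForm' (G.channelOut z θ d u)
        + b⁻¹ * (G.perfOut z θ d u ⬝ᵥ G.perfOut z θ d u)
      < (X⁻¹).toQuadraticForm' z + R'.toQuadraticForm' θ + g⁻¹ * (d ⬝ᵥ d) := by
  have hRR' : R' * R = 1 := mul_eq_one_comm.mp hRR
  have hP : diag3 Xp R (b • (1 : Matrix (Fin ne) (Fin ne) ℝ)) *
      diag3 Xp⁻¹ R' (b⁻¹ • (1 : Matrix (Fin ne) (Fin ne) ℝ)) = 1 := by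
    simp [diag3, diag2_mul_diag2, hXp.mul_inv_self, hRR, hb.ne', diag2_one_one]
  have hM : diag3 X⁻¹ R' (g⁻¹ • (1 : Matrix (Fin nd) (Fin nd) ℝ)) *
      diag3 X R (g • (1 : Matrix (Fin nd) (Fin nd) ℝ)) = 1 := by
    simp [diag3, diag2_mul_diag2, hX.inv_mul_self, hRR', hg.ne', diag2_one_one]
  have hP' : (diag3 Xp⁻¹ R' (b⁻¹ • (1 : Matrix (Fin ne) (Fin ne) ℝ))).PosDef :=
    hXp.inv.diag2 (hR'.diag2 (PosDef.one.smul (inv_pos.mpr hb)))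
  have hM' : (diag3 X⁻¹ R' (g⁻¹ • (1 : Matrix (Fin nd) (Fin nd) ℝ))).PosDef :=
    hX.inv.diag2 (hR'.diag2 (PosDef.one.smul (inv_pos.mpr hg)))
  obtain ⟨u, hu⟩ := exists_toQuadraticForm'_lt_of_dual hP hP' hM hM' G.H G.ctrlRowᵀ (by
    intro y hy hy0
    rw [transpose_transpose] at hy0
    obtain ⟨a, rfl⟩ : y ∈ LinearMap.range NR.mulVecLin := by
      rw [hNR]
      exact hy0
    have ha : a ≠ 0 := by
      rintro rfl
      exact hy (map_zero _)
    have := hLMI.toQuadraticForm'_pos ha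
    rw [neg_toQuadraticForm', transpose_mul_mul_toQuadraticForm', sub_toQuadraticForm'] at this
    have h2 := transpose_mul_mul_toQuadraticForm'
      (diag3 X R (g • (1 : Matrix (Fin nd) (Fin nd) ℝ))) G.Hᵀ (NR *ᵥ a)
    rw [transpose_transpose] at h2
    rw [h2] at this
    rw [mulVecLin_apply]
    linarith) (Sum.elim z (Sum.elim θ d)) (by
    intro h0
    apply hne
    have h1 : z = 0 := funext fun i => congrFun h0 (Sum.inl i)
    have h2 : θ = 0 := funext fun i => congrFun h0 (Sum.inr (Sum.inl i))
    have h3 : d = 0 := funext fun i => congrFun h0 (Sum.inr (Sum.inr i))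
    rw [h1, h2, h3]
    rfl)
  refine ⟨u, ?_⟩
  rwa [G.H_mulVec, diag3_toQuadraticForm', diag3_toQuadraticForm', smul_one_toQuadraticForm',
    smul_one_toQuadraticForm'] at hu

/-- The scalings are `Y = R⁻¹` and `T = S + ηI - R⁻¹`. Full information only sees `Y`, hence the
`R`-inequality; concavity in `(θ, d)` only sees `Y + T`, hence the `S`-inequality. The coupling
condition gives merely `S ≥ R⁻¹`, and the shift by `η` makes `T` positive definite. -/
theorem LFTPlant.exists_dissipative_gain_of_lmi (G : LFTPlant n nb m nd ne nu) {r : ℕ}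
    {NR : Matrix (StateIdx n nb ⊕ (ChanIdx m ⊕ Fin ne)) (Fin r) ℝ}
    (hNR : LinearMap.range NR.mulVecLin = LinearMap.ker G.ctrlRow.mulVecLin)
    {X Xp : Matrix (StateIdx n nb) (StateIdx n nb) ℝ}
    {R S : ∀ i, Matrix (Fin (m i)) (Fin (m i)) ℝ} {b f g t : ℝ}
    (hX : X.PosDef) (hXp : Xp.PosDef) (hR : ∀ i, (R i).PosDef) (hS : ∀ i, (S i).PosDef)
    (hb : 0 < b) (hg : 0 < g)
    (hLMI_R : (-(NRᵀ * (G.H * diag3 X (blockDiagonal' R) (g • (1 : Matrix (Fin nd) (Fin nd) ℝ))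
          * G.Hᵀ - diag3 Xp (blockDiagonal' R) (b • (1 : Matrix (Fin ne) (Fin ne) ℝ)))
          * NR)).PosDef)
    (hLMI_S : (fromBlocks
        (diag2 (blockDiagonal' S) (f • (1 : Matrix (Fin nd) (Fin nd) ℝ))
          - G.H22ᵀ * diag2 (blockDiagonal' S) (t • (1 : Matrix (Fin ne) (Fin ne) ℝ)) * G.H22)
        G.H12ᵀ G.H12 Xp).PosDef)
    (hCoup : ∀ i, (fromBlocks (R i) 1 1 (S i)).PosSemidef)
    (hgf : g⁻¹ ≤ f) (htb : b⁻¹ ≤ t) :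
    ∃ (Y T : ∀ i, Matrix (Fin (m i)) (Fin (m i)) ℝ)
      (Ac : Matrix (ChanIdx m) (ChanIdx m) ℝ) (Bc : Matrix (ChanIdx m) (StateIdx n nb) ℝ)
      (Cc : Matrix (Fin nu) (ChanIdx m) ℝ) (Dc : Matrix (Fin nu) (StateIdx n nb) ℝ) (ε : ℝ),
      (∀ i, (Y i).PosSemidef) ∧ (∀ i, (T i).PosSemidef) ∧
      0 < ε ∧ ∀ ε', 0 ≤ ε' → ε' ≤ ε → ∀ z θ θc d, (z, θ, θc, d) ≠ 0 →
        G.dissipationForm Xp⁻¹ X⁻¹ (blockDiagonal' Y) (blockDiagonal' T) b f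
          (z, θ, θc, d, Ac *ᵥ θc + Bc *ᵥ z, Cc *ᵥ θc + Dc *ᵥ z)
          + ε' * (X⁻¹).toQuadraticForm' z < 0 := by
  have hd0 {ι : Type} [Fintype ι] (x : ι → ℝ) : 0 ≤ x ⬝ᵥ x := by
    simpa using dotProduct_star_self_nonneg x
  -- The second form is the change in the `S`-condition, per unit of `η`, when `S` becomes `S + ηI`;
  -- strictness of the inequality leaves room for it.
  obtain ⟨η, hη, hpert⟩ := QuadraticForm.exists_pos_smul_add_nonpos
    ((Xp⁻¹).toQuadraticForm'.comp G.H12.mulVecLin -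
      (diag2 (blockDiagonal' S) (f • (1 : Matrix (Fin nd) (Fin nd) ℝ))
          - G.H22ᵀ * diag2 (blockDiagonal' S) (t • (1 : Matrix (Fin ne) (Fin ne) ℝ))
            * G.H22).toQuadraticForm')
    (G.H22ᵀ * diag2 (1 : Matrix (ChanIdx m) (ChanIdx m) ℝ) (0 : Matrix (Fin ne) (Fin ne) ℝ) * G.H22
      - diag2 (1 : Matrix (ChanIdx m) (ChanIdx m) ℝ)
        (0 : Matrix (Fin nd) (Fin nd) ℝ)).toQuadraticForm' (fun x hx => by
      have := hLMI_S.toQuadraticForm'_schur_lt hXp hx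
      rw [_root_.sub_apply, QuadraticMap.comp_apply, mulVecLin_apply]
      linarith)
  have hYpos (i) : ((R i)⁻¹).PosDef := (hR i).inv
  have hTpos (i) : (S i + η • 1 - (R i)⁻¹).PosDef := by
    refine PosDef.of_dotProduct_mulVec_pos ?_ fun x hx => ?_
    · exact ((hS i).isHermitian.add (PosDef.one.smul hη).isHermitian).sub (hYpos i).isHermitian
    · rw [star_trivial, ← toQuadraticForm'_eq_dotProduct, sub_toQuadraticForm',
        add_toQuadraticForm']
      have h1 := inv_le_of_fromBlocks_posSemidef (hR i) (hCoup i) x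
      have h2 := (PosDef.one.smul hη : (η • (1 : Matrix (Fin (m i)) _ ℝ)).PosDef
        ).toQuadraticForm'_pos hx
      linarith
  have hYT : blockDiagonal' (fun i => S i + η • 1 - (R i)⁻¹) =
      blockDiagonal' S + η • 1 - blockDiagonal' (fun i => (R i)⁻¹) := by
    rw [← blockDiagonal'_one, ← blockDiagonal'_smul, ← blockDiagonal'_add, ← blockDiagonal'_sub]
    rfl
  have hT (v : ChanIdx m → ℝ) :
      (blockDiagonal' (fun i => S i + η • 1 - (R i)⁻¹)).toQuadraticForm' v =
        (blockDiagonal' S).toQuadraticForm' v + η * (v ⬝ᵥ v)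
          - (blockDiagonal' (fun i => (R i)⁻¹)).toQuadraticForm' v := by
    rw [hYT, sub_toQuadraticForm', add_toQuadraticForm', smul_one_toQuadraticForm']
  have hRR : blockDiagonal' R * blockDiagonal' (fun i => (R i)⁻¹) = 1 := by
    rw [← blockDiagonal'_mul, ← blockDiagonal'_one]
    congr 1
    ext i : 1
    exact (hR i).mul_inv_self
  obtain ⟨Ac, Bc, Cc, Dc, ε, hε, h⟩ := G.exists_dissipative_gain (X := X⁻¹) (f := f) hXp.inv
    (PosDef.blockDiagonal' hYpos) (PosDef.blockDiagonal' hTpos) hb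
    (by
      intro z θ d hne
      obtain ⟨u, hu⟩ := G.exists_full_information_control hNR hX hXp hRR
        (PosDef.blockDiagonal' hYpos) hb hg hLMI_R z θ d hne
      exact ⟨u, hu.trans_le (by gcongr; exact hd0 d)⟩)
    (by
      intro θ d hne
      have h1 := hpert η hη.le le_rfl (Sum.elim θ d) (by
        intro h0
        apply hne
        have h2 : θ = 0 := funext fun i => congrFun h0 (Sum.inl i)
        have h3 : d = 0 := funext fun i => congrFun h0 (Sum.inr i)
        rw [h2, h3]
        rfl)
      simp only [_root_.sub_apply, QuadraticMap.comp_apply, mulVecLin_apply,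
        sub_toQuadraticForm', transpose_mul_mul_toQuadraticForm', G.H12_mulVec, G.H22_mulVec,
        diag2_toQuadraticForm', smul_one_toQuadraticForm'] at h1
      have h4 {ι : Type} [Fintype ι] [DecidableEq ι] (v : ι → ℝ) :
          (1 : Matrix ι ι ℝ).toQuadraticForm' v = v ⬝ᵥ v := by
        rw [toQuadraticForm'_eq_dotProduct, one_mulVec]
      have h5 {ι : Type} [Fintype ι] [DecidableEq ι] (v : ι → ℝ) :
          (0 : Matrix ι ι ℝ).toQuadraticForm' v = 0 := by
        rw [toQuadraticForm'_eq_dotProduct, zero_mulVec, dotProduct_zero]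
      rw [h4, h4, h5, h5] at h1
      have h6 := mul_le_mul_of_nonneg_right htb (hd0 (G.perfOut 0 θ d 0))
      rw [hT, hT]
      linarith)
  exact ⟨_, _, Ac, Bc, Cc, Dc, ε, fun i => (hYpos i).posSemidef, fun i => (hTpos i).posSemidef,
    hε, h⟩

end LinearMatrixInequalities

/-! ### Well-posedness, stability and performance from strict dissipativity. -/

section Loop

open Matrix

variable {n nb p : ℕ} {m : Fin p → ℕ} {nd ne nu : ℕ}

/-- The matrices of a static LFT gain whose scheduling channels have the sizes `m`. -/
structure ChannelGain (n nb : ℕ) {p : ℕ} (m : Fin p → ℕ) (nu : ℕ) where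
  App : Matrix (ChanIdx m) (ChanIdx m) ℝ
  Bp : Matrix (ChanIdx m) (StateIdx n nb) ℝ
  Cp : Matrix (Fin nu) (ChanIdx m) ℝ
  D : Matrix (Fin nu) (StateIdx n nb) ℝ

def ChannelGain.toStaticGain (C : ChannelGain n nb m nu) : StaticGain p n nb nu :=
  ⟨m, C.App, C.Bp, C.Cp, C.D⟩

def ChannelGain.channel (C : ChannelGain n nb m nu) (θc : ChanIdx m → ℝ)
    (z : StateIdx n nb → ℝ) : ChanIdx m → ℝ :=
  C.App *ᵥ θc + C.Bp *ᵥ z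

def ChannelGain.input (C : ChannelGain n nb m nu) (θc : ChanIdx m → ℝ)
    (z : StateIdx n nb → ℝ) : Fin nu → ℝ :=
  C.Cp *ᵥ θc + C.D *ᵥ z

/-- One step of the closed loop: the channel equations that determine `(θ, θc)`. -/
def LFTPlant.IsChannelSolution (G : LFTPlant n nb m nd ne nu) (C : ChannelGain n nb m nu)
    (δ : Fin p → ℝ) (z : StateIdx n nb → ℝ) (d : Fin nd → ℝ)
    (x : (ChanIdx m → ℝ) × (ChanIdx m → ℝ)) : Prop :=
  x.1 = schedMatrix m δ *ᵥ G.channelOut z x.1 d (C.input x.2 z) ∧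
    x.2 = schedMatrix m δ *ᵥ C.channel x.2 z

/-- Decrease, by at least the fraction `ε`, of the storage along one step of the loop. -/
def LFTPlant.StrictlyDissipative (G : LFTPlant n nb m nd ne nu) (C : ChannelGain n nb m nu)
    (Xp X : Matrix (StateIdx n nb) (StateIdx n nb) ℝ) (b f ε : ℝ) : Prop :=
  ∀ (δ : Fin p → ℝ), (∀ i, |δ i| ≤ 1) → ∀ z d θ θc, G.IsChannelSolution C δ z d (θ, θc) →
    (z, θ, θc, d) ≠ 0 →
    Xp.toQuadraticForm' (G.nextState z θ d (C.input θc z))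
      + b⁻¹ * (G.perfOut z θ d (C.input θc z) ⬝ᵥ G.perfOut z θ d (C.input θc z))
      < (1 - ε) * X.toQuadraticForm' z + f * (d ⬝ᵥ d)

/-- Both channels pass through the same scheduling block, so `θ - θc` is the image of `φ - φc` just
as `θ` is that of `φ`. The `Y`- and `T`-terms thus contribute a nonnegative amount to the form and
can be dropped. -/
theorem LFTPlant.strictlyDissipative_of_dissipationForm (G : LFTPlant n nb m nd ne nu)
    (C : ChannelGain n nb m nu) {Xp X : Matrix (StateIdx n nb) (StateIdx n nb) ℝ}
    {Y T : ∀ i, Matrix (Fin (m i)) (Fin (m i)) ℝ} {b f ε : ℝ}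
    (hY : ∀ i, (Y i).PosSemidef) (hT : ∀ i, (T i).PosSemidef)
    (h : ∀ z θ θc d, (z, θ, θc, d) ≠ 0 →
      G.dissipationForm Xp X (blockDiagonal' Y) (blockDiagonal' T) b f
        (z, θ, θc, d, C.App *ᵥ θc + C.Bp *ᵥ z, C.Cp *ᵥ θc + C.D *ᵥ z)
          + ε * X.toQuadraticForm' z < 0) :
    G.StrictlyDissipative C Xp X b f ε := by
  rintro δ hδ z d θ θc ⟨hθ, hθc⟩ hne
  have h1 := h z θ θc d hne
  simp only at hθ hθc
  rw [G.dissipationForm_apply] at h1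
  change _ - _ * _ + _ < _ at h1
  have h2 := toQuadraticForm'_schedMatrix_le hY hδ (G.channelOut z θ d (C.input θc z))
  have h3 := toQuadraticForm'_schedMatrix_le hT hδ
    (G.channelOut z θ d (C.input θc z) - C.channel θc z)
  rw [← hθ] at h2
  rw [mulVec_sub, ← hθ, ← hθc] at h3
  simp only [ChannelGain.input, ChannelGain.channel] at h2 h3 ⊢
  linarith

theorem LFTPlant.StrictlyDissipative.le {G : LFTPlant n nb m nd ne nu}
    {C : ChannelGain n nb m nu} {Xp X : Matrix (StateIdx n nb) (StateIdx n nb) ℝ} {b f ε : ℝ}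
    (h : G.StrictlyDissipative C Xp X b f ε) {δ : Fin p → ℝ} (hδ : ∀ i, |δ i| ≤ 1)
    {z : StateIdx n nb → ℝ} {d : Fin nd → ℝ} {θ θc : ChanIdx m → ℝ}
    (hs : G.IsChannelSolution C δ z d (θ, θc)) :
    Xp.toQuadraticForm' (G.nextState z θ d (C.input θc z))
      + b⁻¹ * (G.perfOut z θ d (C.input θc z) ⬝ᵥ G.perfOut z θ d (C.input θc z))
      ≤ (1 - ε) * X.toQuadraticForm' z + f * (d ⬝ᵥ d) := by
  by_cases h0 : (z, θ, θc, d) = 0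
  · simp only [Prod.mk_eq_zero] at h0
    obtain ⟨rfl, rfl, rfl, rfl⟩ := h0
    simp [LFTPlant.nextState, LFTPlant.perfOut, ChannelGain.input]
  · exact (h δ hδ z d θ θc hs h0).le

/-- The channel equations are a square affine system in `(θ, θc)`. A nonzero solution of the
homogeneous system would be a step with `z = 0` and `d = 0`, where strict dissipativity puts a
nonnegative quantity below zero. -/
theorem LFTPlant.StrictlyDissipative.existsUnique {G : LFTPlant n nb m nd ne nu}
    {C : ChannelGain n nb m nu} {Xp X : Matrix (StateIdx n nb) (StateIdx n nb) ℝ} {b f ε : ℝ}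
    (h : G.StrictlyDissipative C Xp X b f ε) (hXp : Xp.PosSemidef) (hb : 0 < b)
    {δ : Fin p → ℝ} (hδ : ∀ i, |δ i| ≤ 1) (z : StateIdx n nb → ℝ) (d : Fin nd → ℝ) :
    ∃! x, G.IsChannelSolution C δ z d x := by
  let L : (ChanIdx m → ℝ) × (ChanIdx m → ℝ) →ₗ[ℝ] (ChanIdx m → ℝ) × (ChanIdx m → ℝ) :=
    { toFun := fun x => (x.1 - schedMatrix m δ *ᵥ G.channelOut 0 x.1 0 (C.input x.2 0),
        x.2 - schedMatrix m δ *ᵥ C.channel x.2 0)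
      map_add' := fun x y => by
        ext <;> simp [LFTPlant.channelOut, ChannelGain.input, ChannelGain.channel, mulVec_add] <;>
          ring
      map_smul' := fun c x => by
        ext <;> simp [LFTPlant.channelOut, ChannelGain.input, ChannelGain.channel, mulVec_add,
          mulVec_smul] <;> ring }
  have hL (x) : G.IsChannelSolution C δ z d x ↔
      L x = (schedMatrix m δ *ᵥ G.channelOut z 0 d (C.input 0 z),
        schedMatrix m δ *ᵥ C.channel 0 z) := by
    have e1 : G.channelOut z x.1 d (C.input x.2 z) =
        G.channelOut z 0 d (C.input 0 z) + G.channelOut 0 x.1 0 (C.input x.2 0) := by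
      simp [LFTPlant.channelOut, ChannelGain.input, mulVec_add]
      abel
    have e2 : C.channel x.2 z = C.channel 0 z + C.channel x.2 0 := by
      simp [ChannelGain.channel]
      abel
    change _ ↔ (_, _) = _
    rw [LFTPlant.IsChannelSolution, e1, e2, mulVec_add, mulVec_add, Prod.mk.injEq,
      sub_eq_iff_eq_add, sub_eq_iff_eq_add]
  have hinj : Function.Injective L := by
    rw [injective_iff_map_eq_zero]
    rintro ⟨θ, θc⟩ hx
    by_contra hne
    have hx1 : θ = schedMatrix m δ *ᵥ G.channelOut 0 θ 0 (C.input θc 0) :=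
      sub_eq_zero.mp (congrArg Prod.fst hx)
    have hx2 : θc = schedMatrix m δ *ᵥ C.channel θc 0 := sub_eq_zero.mp (congrArg Prod.snd hx)
    have h1 := h δ hδ 0 0 θ θc ⟨hx1, hx2⟩ (by
      intro h0
      simp only [Prod.mk_eq_zero] at h0
      exact hne (Prod.mk_eq_zero.mpr ⟨h0.2.1, h0.2.2.1⟩))
    have h2 := hXp.toQuadraticForm'_nonneg (G.nextState 0 θ 0 (C.input θc 0))
    have h3 : 0 ≤ G.perfOut 0 θ 0 (C.input θc 0) ⬝ᵥ G.perfOut 0 θ 0 (C.input θc 0) := by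
      simpa using dotProduct_star_self_nonneg (G.perfOut 0 θ 0 (C.input θc 0))
    have h4 := mul_nonneg (inv_pos.mpr hb).le h3
    rw [QuadraticMap.map_zero, dotProduct_zero] at h1
    linarith
  obtain ⟨x, hx⟩ := (LinearMap.injective_iff_surjective.mp hinj)
    (schedMatrix m δ *ᵥ G.channelOut z 0 d (C.input 0 z), schedMatrix m δ *ᵥ C.channel 0 z)
  exact ⟨x, (hL x).mpr hx, fun y hy => hinj (((hL y).mp hy).trans hx.symm)⟩

/-- The recursive description of closed-loop trajectories under exact state measurement. -/
theorem isClosedLoopTrajectory_toStaticGain_iff {G : LFTPlant n nb m nd ne nu}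
    (hC2s : G.C2s = 1) (hC2p : G.C2p = 0) (hD21 : G.D21 = 0) {C : ℕ → ChannelGain n nb m nu}
    {δ : ℕ → Fin p → ℝ} {d : ℕ → Fin nd → ℝ}
    {s : LoopSignals n nb m ne nu fun k => (C k).toStaticGain} :
    IsClosedLoopTrajectory G (fun k => (C k).toStaticGain) δ d s ↔
      ∀ k, G.IsChannelSolution (C k) (δ k) (s.z k) (d k) (s.ϑ k, s.ϑc k) ∧
        s.z (k + 1) = G.nextState (s.z k) (s.ϑ k) (d k) ((C k).input (s.ϑc k) (s.z k)) ∧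
        s.φ k = G.channelOut (s.z k) (s.ϑ k) (d k) ((C k).input (s.ϑc k) (s.z k)) ∧
        s.e k = G.perfOut (s.z k) (s.ϑ k) (d k) ((C k).input (s.ϑc k) (s.z k)) ∧
        s.y k = s.z k ∧ s.u k = (C k).input (s.ϑc k) (s.z k) ∧
        s.φc k = (C k).channel (s.ϑc k) (s.z k) := by
  constructor
  · intro h k
    have hy : s.y k = s.z k := by
      have := h.meas k
      simpa [hC2s, hC2p, hD21] using this
    have hu : s.u k = (C k).input (s.ϑc k) (s.z k) := by
      have := h.ctrl_input k
      rwa [hy] at this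
    have hφc : s.φc k = (C k).channel (s.ϑc k) (s.z k) := by
      have := h.ctrl_channel k
      rwa [hy] at this
    have hφ : s.φ k = G.channelOut (s.z k) (s.ϑ k) (d k) ((C k).input (s.ϑc k) (s.z k)) := by
      have := h.channel k
      rwa [hu] at this
    refine ⟨⟨?_, ?_⟩, ?_, hφ, ?_, hy, hu, hφc⟩
    · rw [← hφ]
      exact h.sched k
    · rw [← hφc]
      exact h.ctrl_sched k
    · have := h.state k
      rwa [hu] at this
    · have := h.perf k
      rwa [hu] at this
  · intro h
    refine ⟨fun k => ?_, fun k => ?_, fun k => ?_, fun k => ?_, fun k => ?_, fun k => ?_,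
      fun k => ?_, fun k => ?_⟩ <;> obtain ⟨⟨h1, h2⟩, h3, h4, h5, h6, h7, h8⟩ := h k
    · rw [h3, h7]
      rfl
    · rw [h4, h7]
      rfl
    · rw [h5, h7]
      rfl
    · simp [h6, hC2s, hC2p, hD21]
    · rw [h4]
      exact h1
    · rw [h8, h6]
      rfl
    · rw [h7, h6]
      rfl
    · rw [h8]
      exact h2

theorem LoopSignals.ext_of_forall {K : ℕ → StaticGain p n nb nu}
    {s s' : LoopSignals n nb m ne nu K} (hz : ∀ k, s.z k = s'.z k) (hφ : ∀ k, s.φ k = s'.φ k)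
    (hϑ : ∀ k, s.ϑ k = s'.ϑ k) (he : ∀ k, s.e k = s'.e k) (hy : ∀ k, s.y k = s'.y k)
    (hu : ∀ k, s.u k = s'.u k) (hφc : ∀ k, s.φc k = s'.φc k) (hϑc : ∀ k, s.ϑc k = s'.ϑc k) :
    s = s' := by
  obtain ⟨z, φ, ϑ, e, y, u, φc, ϑc⟩ := s
  obtain ⟨z', φ', ϑ', e', y', u', φc', ϑc'⟩ := s'
  obtain rfl : z = z' := funext hz
  obtain rfl : φ = φ' := funext hφ
  obtain rfl : ϑ = ϑ' := funext hϑ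
  obtain rfl : e = e' := funext he
  obtain rfl : y = y' := funext hy
  obtain rfl : u = u' := funext hu
  obtain rfl : φc = φc' := funext hφc
  obtain rfl : ϑc = ϑc' := funext hϑc
  rfl

theorem wellPosedLoop_of_existsUnique {G : LFTPlant n nb m nd ne nu}
    (hC2s : G.C2s = 1) (hC2p : G.C2p = 0) (hD21 : G.D21 = 0) {C : ℕ → ChannelGain n nb m nu}
    (h : ∀ k δ, (∀ i, |δ i| ≤ 1) → ∀ z d, ∃! x, G.IsChannelSolution (C k) δ z d x) :
    WellPosedLoop G fun k => (C k).toStaticGain := by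
  intro δ hδ z0 d
  choose sol hsol huniq using fun k z => h k (δ k) (hδ k) z (d k)
  let z : ℕ → StateIdx n nb → ℝ := fun k => Nat.rec z0 (fun k zk =>
    G.nextState zk (sol k zk).1 (d k) ((C k).input (sol k zk).2 zk)) k
  let s : LoopSignals n nb m ne nu fun k => (C k).toStaticGain :=
    { z := z
      φ := fun k => G.channelOut (z k) (sol k (z k)).1 (d k) ((C k).input (sol k (z k)).2 (z k))
      ϑ := fun k => (sol k (z k)).1
      e := fun k => G.perfOut (z k) (sol k (z k)).1 (d k) ((C k).input (sol k (z k)).2 (z k))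
      y := z
      u := fun k => (C k).input (sol k (z k)).2 (z k)
      φc := fun k => (C k).channel (sol k (z k)).2 (z k)
      ϑc := fun k => (sol k (z k)).2 }
  refine ⟨s, ⟨rfl, ?_⟩, ?_⟩
  · rw [isClosedLoopTrajectory_toStaticGain_iff hC2s hC2p hD21]
    exact fun k => ⟨hsol k (z k), rfl, rfl, rfl, rfl, rfl, rfl⟩
  · rintro s' ⟨hs0, hs'⟩
    rw [isClosedLoopTrajectory_toStaticGain_iff hC2s hC2p hD21] at hs'
    have hsol' (k) : (s'.ϑ k, s'.ϑc k) = sol k (s'.z k) := huniq k _ _ (hs' k).1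
    have h1 (k) : s'.ϑ k = (sol k (s'.z k)).1 := congrArg Prod.fst (hsol' k)
    have h2 (k) : s'.ϑc k = (sol k (s'.z k)).2 := congrArg Prod.snd (hsol' k)
    have hz (k) : s'.z k = z k := by
      induction k with
      | zero => exact hs0
      | succ k ih => rw [(hs' k).2.1, h1, h2, ih]
    refine LoopSignals.ext_of_forall hz (fun k => ?_) (fun k => ?_) (fun k => ?_) (fun k => ?_)
      (fun k => ?_) (fun k => ?_) (fun k => ?_)
    · rw [(hs' k).2.2.1, h1, h2, hz]
    · rw [h1, hz]
    · rw [(hs' k).2.2.2.1, h1, h2, hz]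
    · rw [(hs' k).2.2.2.2.1, hz]
    · rw [(hs' k).2.2.2.2.2.1, h2, hz]
    · rw [(hs' k).2.2.2.2.2.2, h2, hz]
    · rw [h2, hz]

theorem IsClosedLoopTrajectory.storage_le {G : LFTPlant n nb m nd ne nu}
    (hC2s : G.C2s = 1) (hC2p : G.C2p = 0) (hD21 : G.D21 = 0) {C : ℕ → ChannelGain n nb m nu}
    {X : ℕ → Matrix (StateIdx n nb) (StateIdx n nb) ℝ} {b f ε : ℝ}
    (h : ∀ k, G.StrictlyDissipative (C k) (X (k + 1)) (X k) b f ε)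
    {δ : ℕ → Fin p → ℝ} (hδ : Admissible δ) {d : ℕ → Fin nd → ℝ}
    {s : LoopSignals n nb m ne nu fun k => (C k).toStaticGain}
    (hs : IsClosedLoopTrajectory G (fun k => (C k).toStaticGain) δ d s) (k : ℕ) :
    (X (k + 1)).toQuadraticForm' (s.z (k + 1)) + b⁻¹ * (s.e k ⬝ᵥ s.e k) ≤
      (1 - ε) * (X k).toQuadraticForm' (s.z k) + f * (d k ⬝ᵥ d k) := by
  rw [isClosedLoopTrajectory_toStaticGain_iff hC2s hC2p hD21] at hs
  obtain ⟨h1, h2, -, h3, -⟩ := hs k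
  rw [h2, h3]
  exact (h k).le (hδ k) h1

theorem robustlyStableLoop_of_strictlyDissipative {G : LFTPlant n nb m nd ne nu}
    (hC2s : G.C2s = 1) (hC2p : G.C2p = 0) (hD21 : G.D21 = 0) {C : ℕ → ChannelGain n nb m nu}
    {X : ℕ → Matrix (StateIdx n nb) (StateIdx n nb) ℝ} {b f ε α β : ℝ}
    (h : ∀ k, G.StrictlyDissipative (C k) (X (k + 1)) (X k) b f ε) (hb : 0 < b)
    (hε : 0 < ε) (hε1 : ε ≤ 1) (hα : 0 < α) (hβ : 0 ≤ β)
    (hlow : ∀ k z, α * (z ⬝ᵥ z) ≤ (X k).toQuadraticForm' z)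
    (hup : ∀ k z, (X k).toQuadraticForm' z ≤ β * (z ⬝ᵥ z)) :
    RobustlyStableLoop G fun k => (C k).toStaticGain := by
  -- The storage decays by the factor `1 - ε` per step and lies between `α‖z‖²` and `β‖z‖²`; the
  -- square roots pass from squared norms to norms.
  refine ⟨Real.sqrt (β / α), Real.sqrt (1 - ε), Real.sqrt_nonneg _,
    (Real.sqrt_lt' one_pos).mpr (by linarith), fun δ hδ s hs j k => ?_⟩
  have hdec (k) : (X (k + 1)).toQuadraticForm' (s.z (k + 1)) ≤
      (1 - ε) * (X k).toQuadraticForm' (s.z k) := by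
    have h1 := hs.storage_le hC2s hC2p hD21 h hδ k
    have h2 : 0 ≤ s.e k ⬝ᵥ s.e k := by simpa using dotProduct_star_self_nonneg (s.e k)
    have h3 := mul_nonneg (inv_pos.mpr hb).le h2
    rw [Pi.zero_apply, dotProduct_zero] at h1
    linarith
  have hpow : (X (j + k)).toQuadraticForm' (s.z (j + k)) ≤
      (1 - ε) ^ k * (X j).toQuadraticForm' (s.z j) := by
    induction k with
    | zero => simp
    | succ k ih =>
      calc _ ≤ (1 - ε) * (X (j + k)).toQuadraticForm' (s.z (j + k)) := hdec (j + k)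
        _ ≤ (1 - ε) * ((1 - ε) ^ k * (X j).toQuadraticForm' (s.z j)) :=
          mul_le_mul_of_nonneg_left ih (by linarith)
        _ = _ := by ring
  have hmain : s.z (j + k) ⬝ᵥ s.z (j + k) ≤ β / α * (1 - ε) ^ k * (s.z j ⬝ᵥ s.z j) := by
    have h1 := hlow (j + k) (s.z (j + k))
    have h2 : (1 - ε) ^ k * (X j).toQuadraticForm' (s.z j) ≤
        (1 - ε) ^ k * (β * (s.z j ⬝ᵥ s.z j)) :=
      mul_le_mul_of_nonneg_left (hup j (s.z j)) (pow_nonneg (by linarith) k)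
    have h3 : s.z (j + k) ⬝ᵥ s.z (j + k) ≤ ((1 - ε) ^ k * (β * (s.z j ⬝ᵥ s.z j))) / α := by
      rw [le_div_iff₀ hα]
      linarith
    refine h3.trans_eq ?_
    field_simp
  refine Real.sqrt_le_iff.mpr ⟨mul_nonneg (by positivity) (Real.sqrt_nonneg _), ?_⟩
  have hz : 0 ≤ s.z j ⬝ᵥ s.z j := by simpa using dotProduct_star_self_nonneg (s.z j)
  rw [euclNorm, mul_pow, mul_pow, ← pow_mul, mul_comm k 2, pow_mul, Real.sq_sqrt (by positivity),
    Real.sq_sqrt (by linarith), Real.sq_sqrt hz]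
  exact hmain

theorem sum_range_le_one_of_ell2Norm_le_one {ι : Type*} [Fintype ι] {d : ℕ → ι → ℝ}
    (hd : ell2Norm d ≤ 1) (N : ℕ) : ∑ k ∈ Finset.range N, d k ⬝ᵥ d k ≤ 1 := by
  have h1 : ∑' k, ENNReal.ofReal (d k ⬝ᵥ d k) ≤ 1 := by
    by_contra hlt
    exact absurd hd (not_le.mpr (ENNReal.one_lt_rpow (not_le.mp hlt) (by norm_num)))
  have h2 := (ENNReal.sum_le_tsum (f := fun k => ENNReal.ofReal (d k ⬝ᵥ d k))
    (Finset.range N)).trans h1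
  rw [← ENNReal.ofReal_sum_of_nonneg fun k _ => by
    simpa using dotProduct_star_self_nonneg (d k)] at h2
  exact ENNReal.ofReal_le_one.mp h2

theorem ell2Norm_le_ofReal {ι : Type*} [Fintype ι] {e : ℕ → ι → ℝ} {c : ℝ} (hc : 0 ≤ c)
    (he : ∀ N, ∑ k ∈ Finset.range N, e k ⬝ᵥ e k ≤ c ^ 2) : ell2Norm e ≤ ENNReal.ofReal c := by
  have h1 : ∑' k, ENNReal.ofReal (e k ⬝ᵥ e k) ≤ ENNReal.ofReal (c ^ 2) := by
    refine ENNReal.tsum_le_of_sum_range_le fun N => ?_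
    rw [← ENNReal.ofReal_sum_of_nonneg fun k _ => by
      simpa using dotProduct_star_self_nonneg (e k)]
    exact ENNReal.ofReal_le_ofReal (he N)
  calc ell2Norm e ≤ ENNReal.ofReal (c ^ 2) ^ (1 / 2 : ℝ) :=
        ENNReal.rpow_le_rpow h1 (by norm_num)
    _ = ENNReal.ofReal c := by
        rw [ENNReal.ofReal_rpow_of_nonneg (by positivity) (by norm_num), ← Real.sqrt_eq_rpow,
          Real.sqrt_sq hc]

/-- Summing the dissipation inequality telescopes the storage and gives `‖e‖² ≤ b (v + f)`. The
bound is stated with the arithmetic mean of `b` and `v + f`, which dominates the geometric one and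
is linear in the decision variables. -/
theorem worstCaseOutput_le_of_strictlyDissipative {G : LFTPlant n nb m nd ne nu}
    (hC2s : G.C2s = 1) (hC2p : G.C2p = 0) (hD21 : G.D21 = 0) {C : ℕ → ChannelGain n nb m nu}
    {X : ℕ → Matrix (StateIdx n nb) (StateIdx n nb) ℝ} {b f ε v : ℝ}
    (h : ∀ k, G.StrictlyDissipative (C k) (X (k + 1)) (X k) b f ε) (hb : 0 < b) (hf : 0 ≤ f)
    (hε : 0 ≤ ε) (hX : ∀ k, (X k).PosSemidef) {I : Set (StateIdx n nb → ℝ)} (hv : 0 ≤ v)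
    (hI : ∀ z ∈ I, (X 0).toQuadraticForm' z ≤ v) :
    worstCaseOutput G (fun k => (C k).toStaticGain) I ≤ ENNReal.ofReal ((b + (v + f)) / 2) := by
  refine sSup_le ?_
  rintro _ ⟨δ, d, s, hδ, hd, hz, hs, rfl⟩
  refine ell2Norm_le_ofReal (by positivity) fun N => ?_
  have hsum (N) : (X N).toQuadraticForm' (s.z N) + b⁻¹ * ∑ k ∈ Finset.range N, s.e k ⬝ᵥ s.e k ≤
      (X 0).toQuadraticForm' (s.z 0) + f * ∑ k ∈ Finset.range N, d k ⬝ᵥ d k := by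
    induction N with
    | zero => simp
    | succ N ih =>
      have h1 := hs.storage_le hC2s hC2p hD21 h hδ N
      have h2 := mul_nonneg hε ((hX N).toQuadraticForm'_nonneg (s.z N))
      rw [Finset.sum_range_succ, Finset.sum_range_succ]
      linarith
  have h1 := hsum N
  have h2 := (hX N).toQuadraticForm'_nonneg (s.z N)
  have h3 := hI _ hz
  have h4 := mul_le_mul_of_nonneg_left (sum_range_le_one_of_ell2Norm_le_one hd N) hf
  have h5 : b⁻¹ * ∑ k ∈ Finset.range N, s.e k ⬝ᵥ s.e k ≤ v + f := by linarith
  rw [inv_mul_le_iff₀ hb] at h5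
  -- Arithmetic-geometric mean inequality: `b (v + f) ≤ ((b + (v + f)) / 2)²`.
  nlinarith [sq_nonneg (b - (v + f))]

end Loop

/-! ### Storage bound on the set of initial states. -/

section InitialState

open Matrix

variable {n nb : ℕ}

open scoped MatrixOrder Matrix.Norms.L2Operator in
theorem exists_sqrt_inv_mulVec_eq {ι : Type*} [Fintype ι] [DecidableEq ι] {P : Matrix ι ι ℝ}
    (hP : P.PosDef) (y : ι → ℝ) : ∃ ζ, CFC.sqrt P⁻¹ *ᵥ ζ = y ∧ ζ ⬝ᵥ ζ = P.toQuadraticForm' y := by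
  have h0 : 0 ≤ P⁻¹ := hP.inv.posSemidef.nonneg
  have hsq : CFC.sqrt P⁻¹ * CFC.sqrt P⁻¹ = P⁻¹ := CFC.sqrt_mul_sqrt_self _ h0
  have hsym : (CFC.sqrt P⁻¹)ᵀ = CFC.sqrt P⁻¹ := by
    have : (CFC.sqrt P⁻¹).PosSemidef := nonneg_iff_posSemidef.mp (CFC.sqrt_nonneg _)
    simpa [IsHermitian] using this.isHermitian
  have hinv : CFC.sqrt P⁻¹ * (CFC.sqrt P⁻¹ * P) = 1 := by
    rw [← mul_assoc, hsq, hP.inv_mul_self]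
  -- This is `P^{1/2} y`, written as `P^{-1/2} P y` so that only the square root of `P⁻¹` occurs.
  refine ⟨(CFC.sqrt P⁻¹ * P) *ᵥ y, by rw [mulVec_mulVec, hinv, one_mulVec], ?_⟩
  rw [toQuadraticForm'_eq_dotProduct, dotProduct_mulVec, ← mulVec_transpose, mulVec_mulVec,
    transpose_mul, hsym, mul_assoc, hinv, mul_one, mulVec_transpose, ← dotProduct_mulVec]

/-- `Γ` maps the product of the two unit balls onto the initial set. Writing `z = Γ ζ`, the Schur
complement gives `zᵀ R⁻¹ z ≤ f₁‖ζ₁‖² + f₂‖ζ₂‖²`. -/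
theorem initialSet_toQuadraticForm'_le {P : Matrix (Fin n) (Fin n) ℝ} (hP : P.PosDef)
    {Q : Matrix (Fin nb) (Fin nb) ℝ} (hQ : Q.PosDef)
    {R : Matrix (StateIdx n nb) (StateIdx n nb) ℝ} (hR : R.PosDef) {f₁ f₂ : ℝ}
    (hf₁ : 0 ≤ f₁) (hf₂ : 0 ≤ f₂)
    (h : (fromBlocks (diag2 (f₁ • (1 : Matrix (Fin n) (Fin n) ℝ))
      (f₂ • (1 : Matrix (Fin nb) (Fin nb) ℝ))) (gammaMatrix P Q)ᵀ (gammaMatrix P Q) R).PosDef)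
    {z : StateIdx n nb → ℝ} (hz : z ∈ initialSet P Q) : (R⁻¹).toQuadraticForm' z ≤ f₁ + f₂ := by
  obtain ⟨ζ₁, h1, h1'⟩ := exists_sqrt_inv_mulVec_eq hP (fun i => z (Sum.inl i))
  obtain ⟨ζ₂, h2, h2'⟩ := exists_sqrt_inv_mulVec_eq hQ (fun i => z (Sum.inr i))
  have hΓ : gammaMatrix P Q *ᵥ Sum.elim ζ₁ ζ₂ = z := by
    ext (i | i)
    · simpa [gammaMatrix, diag2, fromBlocks_mulVec] using congrFun h1 i
    · simpa [gammaMatrix, diag2, fromBlocks_mulVec] using congrFun h2 i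
  have h3 := h.posSemidef.toQuadraticForm'_schur_le hR (Sum.elim ζ₁ ζ₂)
  rw [hΓ, diag2_toQuadraticForm', smul_one_toQuadraticForm', smul_one_toQuadraticForm', h1', h2',
    toQuadraticForm'_eq_dotProduct P, toQuadraticForm'_eq_dotProduct Q] at h3
  have h4 := mul_le_mul_of_nonneg_left hz.1 hf₁
  have h5 := mul_le_mul_of_nonneg_left hz.2 hf₂
  linarith

end InitialState

/-! ### Uniform constants over the finite horizon, and the synthesis theorem. -/

theorem exists_pos_forall_le_of_forall_exists {h : ℕ} {A : ℕ → ℝ → Prop}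
    (hA : ∀ k ≤ h, ∃ ε : ℝ, 0 < ε ∧ ∀ ε', 0 ≤ ε' → ε' ≤ ε → A k ε') :
    ∃ ε : ℝ, 0 < ε ∧ ε ≤ 1 ∧ ∀ k ≤ h, A k ε := by
  choose ε hε hA using hA
  have hne : (Finset.univ : Finset (Fin (h + 1))).Nonempty := Finset.univ_nonempty
  let e : Fin (h + 1) → ℝ := fun k => ε k (Nat.lt_succ_iff.mp k.2)
  have hpos : 0 < Finset.univ.inf' hne e := (Finset.lt_inf'_iff hne).mpr fun k _ => hε _ _
  refine ⟨min 1 (Finset.univ.inf' hne e), lt_min one_pos hpos, min_le_left _ _, fun k hk => ?_⟩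
  exact hA k hk _ (le_min one_pos.le hpos.le) ((min_le_right _ _).trans
    (Finset.inf'_le e (Finset.mem_univ ⟨k, Nat.lt_succ_iff.mpr hk⟩)))

theorem exists_uniform_quadratic_bounds {ι : Type*} [Fintype ι] [DecidableEq ι] {h : ℕ}
    {X : ℕ → Matrix ι ι ℝ} (hX : ∀ k ≤ h, (X k).PosDef) :
    ∃ α β : ℝ, 0 < α ∧ 0 ≤ β ∧ ∀ k ≤ h, ∀ z : ι → ℝ,
      α * (z ⬝ᵥ z) ≤ (X k).toQuadraticForm' z ∧ (X k).toQuadraticForm' z ≤ β * (z ⬝ᵥ z) := by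
  have hone (z : ι → ℝ) : (1 : Matrix ι ι ℝ).toQuadraticForm' z = z ⬝ᵥ z := by
    rw [Matrix.toQuadraticForm'_eq_dotProduct, Matrix.one_mulVec]
  obtain ⟨α, hα, -, hα'⟩ := exists_pos_forall_le_of_forall_exists fun k hk =>
    QuadraticForm.exists_pos_smul_add_nonpos (-(X k).toQuadraticForm')
      (1 : Matrix ι ι ℝ).toQuadraticForm' fun x hx => by
        rw [neg_apply]
        exact neg_neg_of_pos ((hX k hk).toQuadraticForm'_pos hx)
  obtain ⟨β, hβ, -, hβ'⟩ := exists_pos_forall_le_of_forall_exists fun k (hk : k ≤ h) =>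
    QuadraticForm.exists_pos_smul_add_nonpos (-(1 : Matrix ι ι ℝ).toQuadraticForm')
      (X k).toQuadraticForm' fun x hx => by
        rw [neg_apply]
        exact neg_neg_of_pos (Matrix.PosDef.one.toQuadraticForm'_pos hx)
  -- The two perturbation bounds read `α I < X` and `β X < I`; the second gives the upper constant
  -- `β⁻¹`.
  refine ⟨α, β⁻¹, hα, (inv_pos.mpr hβ).le, fun k hk z => ?_⟩
  by_cases hz : z = 0
  · subst hz
    simp
  · have h1 := hα' k hk z hz
    have h2 := hβ' k hk z hz
    rw [neg_apply, hone] at h1 h2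
    refine ⟨by linarith, ?_⟩
    rw [le_inv_mul_iff₀ hβ]
    linarith

theorem theorem1 {n nb p : ℕ} {m : Fin p → ℕ} {nd ne nu : ℕ}
    (G : LFTPlant n nb m nd ne nu)
    (P : Matrix (Fin n) (Fin n) ℝ) (hP : P.PosDef)
    (Q : Matrix (Fin nb) (Fin nb) ℝ) (hQ : Q.PosDef)
    (hC2s : G.C2s = 1) (hC2p : G.C2p = 0) (hD21 : G.D21 = 0)
    (r : ℕ) (NR : Matrix (StateIdx n nb ⊕ (ChanIdx m ⊕ Fin ne)) (Fin r) ℝ)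
    (hNR : LinearMap.range NR.mulVecLin = LinearMap.ker G.ctrlRow.mulVecLin)
    (hNR' : NR.transpose * NR = 1)
    (γ : ℝ) (hbar : ℕ)
    (R0 : ℕ → Matrix (StateIdx n nb) (StateIdx n nb) ℝ)
    (R S : ℕ → (i : Fin p) → Matrix (Fin (m i)) (Fin (m i)) ℝ)
    (b f11 f12 f2 g t : ℝ)
    (hb : 0 < b) (hf11 : 0 < f11) (hf12 : 0 < f12) (hf2 : 0 < f2) (hg : 0 < g) (ht : 0 < t)
    (hR0 : ∀ k ≤ hbar, (R0 k).PosDef)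
    (hR : ∀ k ≤ hbar, ∀ i, (R k i).PosDef)
    (hS : ∀ k ≤ hbar, ∀ i, (S k i).PosDef)
    (hR0_end : R0 (hbar + 1) = R0 hbar)
    (hγ : b + f11 + f12 + f2 < 2 * γ)
    (hInit : (Matrix.fromBlocks
      (diag2 (f11 • (1 : Matrix (Fin n) (Fin n) ℝ)) (f12 • (1 : Matrix (Fin nb) (Fin nb) ℝ)))
      (gammaMatrix P Q).transpose (gammaMatrix P Q) (R0 0)).PosDef)
    (hLMI_R : ∀ k ≤ hbar,
      (-(NR.transpose *
        (G.H * diag3 (R0 k) (Matrix.blockDiagonal' (R k)) (g • (1 : Matrix (Fin nd) (Fin nd) ℝ))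
            * G.H.transpose
          - diag3 (R0 (k + 1)) (Matrix.blockDiagonal' (R k))
              (b • (1 : Matrix (Fin ne) (Fin ne) ℝ)))
        * NR)).PosDef)
    (hLMI_S : ∀ k ≤ hbar,
      (Matrix.fromBlocks
        (diag2 (Matrix.blockDiagonal' (S k)) (f2 • (1 : Matrix (Fin nd) (Fin nd) ℝ))
          - G.H22.transpose
              * diag2 (Matrix.blockDiagonal' (S k)) (t • (1 : Matrix (Fin ne) (Fin ne) ℝ))
              * G.H22)
        G.H12.transpose G.H12 (R0 (k + 1))).PosDef)
    (hCoup : ∀ k ≤ hbar, ∀ i, (Matrix.fromBlocks (R k i) 1 1 (S k i)).PosSemidef)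
    (hgf : (!![g, 1; 1, f2] : Matrix (Fin 2) (Fin 2) ℝ).PosSemidef)
    (htb : (!![t, 1; 1, b] : Matrix (Fin 2) (Fin 2) ℝ).PosSemidef) :
    ∃ K : ℕ → StaticGain p n nb nu,
      IsEventuallyPeriodic hbar 1 K ∧
      (∀ k i, (K k).dim i ≤ m i) ∧
      WellPosedLoop G K ∧
      RobustlyStableLoop G K ∧
      worstCaseOutput G K (initialSet P Q) < ENNReal.ofReal γ := by
  obtain ⟨C, ε, hε, hε1, hC⟩ : ∃ (C : ℕ → ChannelGain n nb m nu) (ε : ℝ), 0 < ε ∧ ε ≤ 1 ∧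
      ∀ k ≤ hbar, G.StrictlyDissipative (C k) (R0 (k + 1))⁻¹ (R0 k)⁻¹ b f2 ε := by
    have hstep (k) (hk : k ≤ hbar) : ∃ (C : ChannelGain n nb m nu) (ε : ℝ), 0 < ε ∧
        ∀ ε', 0 ≤ ε' → ε' ≤ ε →
          G.StrictlyDissipative C (R0 (k + 1))⁻¹ (R0 k)⁻¹ b f2 ε' := by
      -- Positivity is assumed only up to `hbar`; at `k = hbar` it comes from `R0 (hbar + 1) = R0
      -- hbar`.
      have hR0' : (R0 (k + 1)).PosDef := by
        rcases hk.eq_or_lt with rfl | hlt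
        · rw [hR0_end]
          exact hR0 k le_rfl
        · exact hR0 _ hlt
      obtain ⟨Y, T, Ac, Bc, Cc, Dc, ε, hY, hT, hε, h⟩ := G.exists_dissipative_gain_of_lmi hNR
        (hR0 k hk) hR0' (hR k hk) (hS k hk) hb hg (hLMI_R k hk) (hLMI_S k hk) (hCoup k hk)
        (by
          rw [inv_le_comm₀ hg hf2]
          exact inv_le_of_posSemidef_fin_two hf2 hgf)
        (inv_le_of_posSemidef_fin_two hb htb)
      exact ⟨⟨Ac, Bc, Cc, Dc⟩, ε, hε, fun ε' h0 h1 =>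
        G.strictlyDissipative_of_dissipationForm _ hY hT (h ε' h0 h1)⟩
    have : Nonempty (ChannelGain n nb m nu) := ⟨⟨0, 0, 0, 0⟩⟩
    choose! C hC using hstep
    exact ⟨C, exists_pos_forall_le_of_forall_exists hC⟩
  have hmin (k) : min k hbar ≤ hbar := min_le_right _ _
  -- Time is frozen at `hbar`. The end condition makes the storage the same before and after step
  -- `hbar`, so that step's gain can be repeated forever.
  have hRnext (k) : R0 (min k hbar + 1) = R0 (min (k + 1) hbar) := by
    rcases lt_or_ge k hbar with hk | hk
    · rw [min_eq_left hk.le, min_eq_left (Nat.succ_le_of_lt hk)]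
    · rw [min_eq_right hk, min_eq_right (hk.trans k.le_succ), hR0_end]
  have hdiss (k) : G.StrictlyDissipative (C (min k hbar)) (R0 (min (k + 1) hbar))⁻¹
      (R0 (min k hbar))⁻¹ b f2 ε := hRnext k ▸ hC _ (hmin k)
  have hXpos (k) : ((R0 (min k hbar))⁻¹).PosDef := (hR0 _ (hmin k)).inv
  obtain ⟨α, β, hα, hβ, hαβ⟩ := exists_uniform_quadratic_bounds fun k hk => (hR0 k hk).inv
  refine ⟨fun k => (C (min k hbar)).toStaticGain, ⟨le_rfl, fun i k => ?_⟩, fun k i => le_rfl,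
    ?_, ?_, ?_⟩
  · simp only [min_eq_right (show hbar ≤ hbar + k + i * 1 by omega),
      min_eq_right (show hbar ≤ hbar + k by omega)]
  · exact wellPosedLoop_of_existsUnique hC2s hC2p hD21 fun k δ hδ z d =>
      (hdiss k).existsUnique (hXpos (k + 1)).posSemidef hb hδ z d
  · exact robustlyStableLoop_of_strictlyDissipative (X := fun k => (R0 (min k hbar))⁻¹)
      hC2s hC2p hD21 hdiss hb hε hε1 hα hβ (fun k z => (hαβ _ (hmin k) z).1)
      fun k z => (hαβ _ (hmin k) z).2
  · refine (worstCaseOutput_le_of_strictlyDissipative (X := fun k => (R0 (min k hbar))⁻¹)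
      hC2s hC2p hD21 hdiss hb hf2.le hε.le (fun k => (hXpos k).posSemidef)
      (add_pos hf11 hf12).le fun z hz => ?_).trans_lt
      ((ENNReal.ofReal_lt_ofReal_iff (by linarith)).mpr (by linarith))
    rw [Nat.zero_min]
    exact initialSet_toQuadraticForm'_le hP hQ (hR0 0 hbar.zero_le) hf11.le hf12.le hInit hz
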